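/- Let $L_2(\mathbb{R})$ be the complex Hilbert space with inner product $(\cdot,\cdot)$ linear in the second argument, and let $W_2^2(\mathbb{R}\setminus\{0\})$ be the space of $f\in L_2(\mathbb{R})$ whose first and second weak derivatives on $\mathbb{R}\setminus\{0\}$ belong to $L_2(\mathbb{R})$. For such $f$ the one-sided values $f(0\pm)$, $f'(0\pm)$ exist (for the continuous representatives); put $$f_r(0)=\tfrac{f(0+)+f(0-)}{2},\quad f_r'(0)=\tfrac{f'(0+)+f'(0-)}{2},\quad f_s(0)=f(0+)-f(0-),\quad f_s'(0)=f'(0+)-f'(0-).$$ Let $q_1,q_2\in L_2(\mathbb{R})$, let $a,b,c,d\in\mathbb{C}$ and $\mathbf{T}=\begin{bmatrix}a&b\\c&d\end{bmatrix}$, and put $$\Gamma_0f=\begin{bmatrix}f_r(0)\\-f_r'(0)\end{bmatrix},\qquad \Gamma_1f=\begin{bmatrix}f_s'(0)-(q_1,f)\\f_s(0)-(q_2,f)\end{bmatrix}.$$ Let $H_{\mathbf{T}}$ be the operator in $L_2(\mathbb{R})$ given by $$H_{\mathbf{T}}f=-\{f''(x)\}_{x\neq0}+f_r(0)\,q_1-f_r'(0)\,q_2,\qquad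 \mathcal{D}(H_{\mathbf{T}})=\{f\in W_2^2(\mathbb{R}\setminus\{0\}):\ \mathbf{T}\Gamma_0f-\Gamma_1f=0\},$$ where $\{f''(x)\}_{x\neq 0}$ is the weak second derivative on $\mathbb{R}\setminus\{0\}$. Let $\mathcal{P}$ be the parity operator $\mathcal{P}f(x)=f(-x)$ on $L_2(\mathbb{R})$. **Lemma 3.3.** If $a,d\in\mathbb{R}$, $b=-c^*$ (where $^*$ is complex conjugation), $\mathcal{P}q_1=q_1$ and $\mathcal{P}q_2=-q_2$, then $H_{\mathbf{T}}$ is $\mathcal{P}$-self-adjoint: $H_{\mathbf{T}}$ is densely defined, so that its adjoint $H_{\mathbf{T}}^\dagger$ exists, and $$\mathcal{P}H_{\mathbf{T}}=H_{\mathbf{T}}^\dagger\mathcal{P}$$ as an equality of unbounded operators, including equality of the domains $\mathcal{D}(H_{\mathbf{T}})=\{f\in L_2(\mathbb{R}):\ \mathcal{P}f\in\mathcal{D}(H_{\mathbf{T}}^\dagger)\}$. -/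

import Mathlib

open MeasureTheory Filter Topology
open scoped ContDiff ComplexConjugate

noncomputable section

namespace NonlocalPoint

/-- The complex Hilbert space `L₂(ℝ)`. Mathlib's `inner ℂ f g` is linear in the second argument. -/
abbrev L2R : Type := Lp ℂ 2 (volume : Measure ℝ)

/-! ### Test functions, weak derivatives and traces on `ℝ \ {0}` -/

/-- `φ` is a real test function on the set `U`: smooth, with compact support inside `U`. -/
def IsTestOn (U : Set ℝ) (φ : ℝ → ℝ) : Prop :=
  ContDiff ℝ ∞ φ ∧ HasCompactSupport φ ∧ tsupport φ ⊆ U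

/-- `g` is the weak (distributional) derivative of `f` on the open set `ℝ \ {0}`. -/
def HasWeakDeriv (f g : L2R) : Prop :=
  ∀ φ : ℝ → ℝ, IsTestOn {0}ᶜ φ → ∫ x, deriv φ x • f x = - ∫ x, φ x • g x

/-- Approach to `0` from the right, disregarding null sets. -/
def rightOfZero : Filter ℝ := 𝓝[>] 0 ⊓ ae volume

/-- Approach to `0` from the left, disregarding null sets. -/
def leftOfZero : Filter ℝ := 𝓝[<] 0 ⊓ ae volume

/-- `f(0+)`: the essential limit of `f` at `0` from the right. It does not depend on the
representative of `f`, and it exists as soon as `f` has a weak derivative in `L₂(ℝ)`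
(`HasWeakDeriv.exists_right`); it is then `f(0+)` for the continuous representative. -/
def valRight (f : L2R) : ℂ := limUnder rightOfZero (f : ℝ → ℂ)

/-- `f(0-)`: the essential limit of `f` at `0` from the left. -/
def valLeft (f : L2R) : ℂ := limUnder leftOfZero (f : ℝ → ℂ)

/-! ### Existence of traces -/

theorem IsTestOn.intervalBounds {S : Set ℝ} (hne : S.Nonempty)
    {h : ℝ → ℝ} (hh : HasCompactSupport h) (hs : tsupport h ⊆ S) :
    ∃ a ∈ S, ∃ b ∈ S, tsupport h ⊆ Set.Icc a b := by
  rcases (tsupport h).eq_empty_or_nonempty with he | hn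
  · obtain ⟨s, hs⟩ := hne
    exact ⟨s, hs, s, hs, by simp [he]⟩
  · have hc : IsCompact (tsupport h) := hh
    refine ⟨sInf (tsupport h), hs (hc.sInf_mem hn), sSup (tsupport h), hs (hc.sSup_mem hn), ?_⟩
    intro x hx
    exact ⟨csInf_le hc.bddBelow hx, le_csSup hc.bddAbove hx⟩

/-- A smooth function with zero mean and compact support in an open interval is the derivative of
a test function on that interval. -/
theorem IsTestOn.exists_primitive {S : Set ℝ} (hS : S.OrdConnected) (hne : S.Nonempty)
    {h : ℝ → ℝ} (hh : IsTestOn S h) (h0 : ∫ x, h x = 0) :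
    ∃ φ, IsTestOn S φ ∧ deriv φ = h := by
  obtain ⟨a, ha, b, hb, hab⟩ := IsTestOn.intervalBounds hne hh.2.1 hh.2.2
  have hcont : Continuous h := hh.1.continuous
  have hd : ∀ x, HasDerivAt (fun x => ∫ t in a..x, h t) (h x) x := fun x =>
    intervalIntegral.integral_hasDerivAt_right (hcont.intervalIntegrable _ _)
      (hcont.stronglyMeasurableAtFilter _ _) hcont.continuousAt
  have hderiv : deriv (fun x => ∫ t in a..x, h t) = h := funext fun x => (hd x).deriv
  have hz : ∀ t, t ∉ Set.Icc a b → h t = 0 := fun t ht =>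
    image_eq_zero_of_notMem_tsupport fun h' => ht (hab h')
  have hab' : ∀ x, x ∉ Set.Icc a b → ∫ t in a..x, h t = 0 := by
    intro x hx
    rcases lt_or_ge x a with hxa | hxa
    · rw [intervalIntegral.integral_symm, intervalIntegral.integral_of_le hxa.le,
        integral_Ioc_eq_integral_Ioo, neg_eq_zero]
      refine setIntegral_eq_zero_of_forall_eq_zero fun t ht => hz t fun h' => ?_
      exact absurd h'.1 (not_le.2 ht.2)
    · have hbx : b < x := by
        by_contra hc
        exact hx ⟨hxa, not_lt.1 hc⟩
      rw [intervalIntegral.integral_of_le hxa, ← integral_Icc_eq_integral_Ioc,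
        setIntegral_eq_integral_of_forall_compl_eq_zero, h0]
      intro t ht
      exact hz t fun h' => ht ⟨h'.1, h'.2.trans hbx.le⟩
  have hsupp : tsupport (fun x => ∫ t in a..x, h t) ⊆ Set.Icc a b := by
    refine closure_minimal (fun x hx => ?_) isClosed_Icc
    by_contra hc
    exact hx (hab' x hc)
  refine ⟨fun x => ∫ t in a..x, h t, ⟨?_, ?_, hsupp.trans (hS.out ha hb)⟩, hderiv⟩
  · rw [contDiff_infty_iff_deriv]
    exact ⟨fun x => (hd x).differentiableAt, by rw [hderiv]; exact hh.1⟩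
  · exact isCompact_Icc.of_isClosed_subset (isClosed_tsupport _) hsupp

theorem IsTestOn.integrable_smul {S : Set ℝ} {h f : ℝ → ℝ} (hh : IsTestOn S h)
    (hf : LocallyIntegrable f volume) : Integrable (fun x => h x * f x) := by
  simpa using hf.integrable_smul_left_of_hasCompactSupport hh.1.continuous hh.2.1

theorem IsTestOn.deriv {S : Set ℝ} {h : ℝ → ℝ} (hh : IsTestOn S h) : IsTestOn S (deriv h) :=
  ⟨(contDiff_infty_iff_deriv.1 hh.1).2, hh.2.1.deriv,
    (tsupport_deriv_subset).trans hh.2.2⟩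

/-- A function on an open interval with zero weak derivative is a.e. constant. -/
theorem ae_const_of_weakDeriv_zero {S : Set ℝ} (hS : S.OrdConnected) (ho : IsOpen S)
    (hne : S.Nonempty) {f : ℝ → ℝ} (hf : LocallyIntegrable f volume)
    (h : ∀ φ, IsTestOn S φ → ∫ x, deriv φ x * f x = 0) :
    ∃ c : ℝ, ∀ᵐ x, x ∈ S → f x = c := by
  obtain ⟨s, hs⟩ := hne
  obtain ⟨ε, hε, hball⟩ := Metric.isOpen_iff.1 ho s hs
  let B : ContDiffBump s := ⟨ε / 4, ε / 2, by positivity, by linarith⟩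
  have hρ : IsTestOn S (B.normed volume) := by
    refine ⟨B.contDiff_normed, B.hasCompactSupport_normed, ?_⟩
    rw [B.tsupport_normed_eq]
    exact (Metric.closedBall_subset_ball (by change ε / 2 < ε; linarith)).trans hball
  have hρ1 : ∫ x, B.normed volume x = 1 := B.integral_normed
  set ρ : ℝ → ℝ := B.normed volume with hρdef
  refine ⟨∫ x, ρ x * f x, ?_⟩
  set c := ∫ x, ρ x * f x with hc
  have key := ho.ae_eq_zero_of_integral_contDiff_smul_eq_zero (μ := volume)
    (f := fun x => f x - c)
    ((hf.sub (locallyIntegrable_const c)).locallyIntegrableOn S) (by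
      intro g hg1 hg2 hg3
      have hg : IsTestOn S g := ⟨hg1, hg2, hg3⟩
      have hgi : Integrable g := hg1.continuous.integrable_of_hasCompactSupport hg2
      have hρi : Integrable ρ := hρ.1.continuous.integrable_of_hasCompactSupport hρ.2.1
      set m := ∫ x, g x with hm
      have ht : IsTestOn S (fun x => g x - m * ρ x) := by
        have hs2 : Function.support (fun x => g x - m * ρ x) ⊆ tsupport g ∪ tsupport ρ := by
          intro x hx
          by_contra hc
          rw [Set.mem_union, not_or] at hc
          apply hx
          simp [image_eq_zero_of_notMem_tsupport hc.1, image_eq_zero_of_notMem_tsupport hc.2]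
        have hs3 : tsupport (fun x => g x - m * ρ x) ⊆ tsupport g ∪ tsupport ρ :=
          closure_minimal hs2 ((isClosed_tsupport _).union (isClosed_tsupport _))
        refine ⟨hg1.sub (contDiff_const.mul hρ.1), ?_, hs3.trans (Set.union_subset hg3 hρ.2.2)⟩
        exact (IsCompact.union hg2 hρ.2.1).of_isClosed_subset (isClosed_tsupport _) hs3
      have h0 : ∫ x, (g x - m * ρ x) = 0 := by
        rw [integral_sub hgi (hρi.const_mul m), integral_const_mul, hρ1]
        simp [hm]
      obtain ⟨φ, hφ, hφd⟩ := ht.exists_primitive hS ⟨s, hs⟩ h0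
      have h1 := h φ hφ
      rw [hφd] at h1
      have e1 : ∀ x, (g x - m * ρ x) * f x = g x * f x - m * (ρ x * f x) := fun x => by ring
      simp_rw [e1] at h1
      rw [integral_sub (hg.integrable_smul hf) ((hρ.integrable_smul hf).const_mul m),
        integral_const_mul] at h1
      have e2 : ∀ x, g x • (f x - c) = g x * f x - g x * c := fun x => by
        rw [smul_eq_mul]; ring
      simp_rw [e2]
      rw [integral_sub (hg.integrable_smul hf) (hgi.mul_const c), integral_mul_const]
      exact h1)
  filter_upwards [key] with x hx hxS
  exact sub_eq_zero.1 (hx hxS)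

theorem intervalIntegrable_of_loc {g : ℝ → ℝ} (hg : LocallyIntegrable g volume) (a b : ℝ) :
    IntervalIntegrable g volume a b :=
  (intervalIntegrable_iff').2 (hg.integrableOn_isCompact isCompact_uIcc)

/-- Integration by parts of a primitive against a test function. -/
theorem IsTestOn.integral_deriv_mul_primitive {S : Set ℝ} {φ g : ℝ → ℝ} (hφ : IsTestOn S φ)
    (hg : LocallyIntegrable g volume) :
    ∫ x, _root_.deriv φ x * (∫ t in (0 : ℝ)..x, g t) = - ∫ x, φ x * g x := by
  obtain ⟨R, hR0, hR⟩ : ∃ R : ℝ, 0 < R ∧ tsupport φ ⊆ Set.Ioo (-R) R := by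
    obtain ⟨R, hR⟩ := hφ.2.1.isBounded.subset_ball (0 : ℝ)
    refine ⟨max R 1, by positivity, hR.trans ?_⟩
    rw [Real.ball_eq_Ioo]
    exact Set.Ioo_subset_Ioo (by simp) (by simp)
  have hz : ∀ x, x ∉ Set.Ioo (-R) R → φ x = 0 := fun x hx =>
    image_eq_zero_of_notMem_tsupport fun h' => hx (hR h')
  have hz' : ∀ x, x ∉ Set.Ioo (-R) R → _root_.deriv φ x = 0 := fun x hx =>
    image_eq_zero_of_notMem_tsupport fun h' => hx (hR (tsupport_deriv_subset h'))
  have conv : ∀ u : ℝ → ℝ, (∀ x, x ∉ Set.Ioo (-R) R → u x = 0) →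
      ∫ x, u x = ∫ x in (-R)..R, u x := by
    intro u hu
    rw [intervalIntegral.integral_of_le (by linarith), integral_Ioc_eq_integral_Ioo,
      setIntegral_eq_integral_of_forall_compl_eq_zero hu]
  have hgi : IntervalIntegrable g volume (-R) R := intervalIntegrable_of_loc hg _ _
  have hac1 : AbsolutelyContinuousOnInterval φ (-R) R :=
    ContDiffOn.absolutelyContinuousOnInterval
      ((hφ.1.of_le (by exact_mod_cast le_top)).contDiffOn)
  have hac2 : AbsolutelyContinuousOnInterval (fun x => ∫ t in (0 : ℝ)..x, g t) (-R) R :=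
    hgi.absolutelyContinuousOnInterval_intervalIntegral
      (by rw [Set.uIcc_of_le (by linarith)]; constructor <;> linarith)
  have hibp := hac1.integral_mul_deriv_eq_deriv_mul hac2
  have hφ1 : φ R = 0 := hz _ (by simp)
  have hφ2 : φ (-R) = 0 := hz _ (by simp)
  have hd : ∫ x in (-R)..R, φ x * _root_.deriv (fun x => ∫ t in (0 : ℝ)..x, g t) x
      = ∫ x in (-R)..R, φ x * g x := by
    apply intervalIntegral.integral_congr_ae
    filter_upwards [LocallyIntegrable.ae_hasDerivAt_integral hg] with x hx _
    rw [(hx 0).deriv]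
  rw [hd, hφ1, hφ2] at hibp
  rw [conv _ (fun x hx => by simp [hz' x hx]), conv (fun x => φ x * g x)
    (fun x hx => by simp [hz x hx]), hibp]
  ring

theorem exists_trace_real {S : Set ℝ} (hS : S.OrdConnected) (ho : IsOpen S)
    (hne : S.Nonempty) {f g : ℝ → ℝ} (hf : LocallyIntegrable f volume)
    (hg : LocallyIntegrable g volume)
    (h : ∀ φ, IsTestOn S φ → ∫ x, deriv φ x * f x = - ∫ x, φ x * g x) :
    ∃ c : ℝ, Tendsto f (𝓝[S] 0 ⊓ ae volume) (𝓝 c) := by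
  have hF : Continuous (fun x => ∫ t in (0 : ℝ)..x, g t) :=
    intervalIntegral.continuous_primitive (intervalIntegrable_of_loc hg) 0
  obtain ⟨c, hc⟩ := ae_const_of_weakDeriv_zero hS ho hne
    (f := fun x => f x - ∫ t in (0 : ℝ)..x, g t) (hf.sub hF.locallyIntegrable) (by
      intro φ hφ
      simp_rw [mul_sub]
      rw [integral_sub (hφ.deriv.integrable_smul hf)
        (hφ.deriv.integrable_smul hF.locallyIntegrable), h φ hφ,
        hφ.integral_deriv_mul_primitive hg, sub_self])
  refine ⟨c, ?_⟩
  have h1 : Tendsto (fun x => c + ∫ t in (0 : ℝ)..x, g t) (𝓝[S] 0 ⊓ ae volume) (𝓝 c) := by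
    have : Tendsto (fun x => c + ∫ t in (0 : ℝ)..x, g t) (𝓝 0) (𝓝 c) := by
      have := (continuous_const.add hF).tendsto (0 : ℝ) (f := fun x => c + ∫ t in (0 : ℝ)..x, g t)
      simpa using this
    exact this.mono_left (inf_le_left.trans nhdsWithin_le_nhds)
  refine h1.congr' ?_
  have hS' : ∀ᶠ x in 𝓝[S] 0 ⊓ ae volume, x ∈ S :=
    inf_le_left (a := 𝓝[S] (0 : ℝ)) self_mem_nhdsWithin
  have hc' : ∀ᶠ x in 𝓝[S] 0 ⊓ ae volume, x ∈ S → f x - ∫ t in (0 : ℝ)..x, g t = c :=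
    inf_le_right (a := 𝓝[S] (0 : ℝ)) hc
  filter_upwards [hS', hc'] with x hx hx'
  rw [← hx' hx]; ring

theorem L2R.locallyIntegrable (f : L2R) : LocallyIntegrable (f : ℝ → ℂ) volume :=
  (Lp.memLp f).locallyIntegrable (by norm_num)

theorem HasWeakDeriv.exists_trace {f g : L2R} (h : HasWeakDeriv f g) {S : Set ℝ}
    (hS : S.OrdConnected) (ho : IsOpen S) (hne : S.Nonempty) (h0 : S ⊆ {0}ᶜ) :
    ∃ c : ℂ, Tendsto (f : ℝ → ℂ) (𝓝[S] 0 ⊓ ae volume) (𝓝 c) := by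
  have hf := L2R.locallyIntegrable f
  have hg := L2R.locallyIntegrable g
  have test : ∀ φ, IsTestOn S φ → Integrable (fun x => φ x • f x) ∧
      Integrable (fun x => φ x • g x) := fun φ hφ =>
    ⟨hf.integrable_smul_left_of_hasCompactSupport hφ.1.continuous hφ.2.1,
      hg.integrable_smul_left_of_hasCompactSupport hφ.1.continuous hφ.2.1⟩
  have part : ∀ L : ℂ →L[ℝ] ℝ, ∃ c : ℝ,
      Tendsto (fun x => L (f x)) (𝓝[S] 0 ⊓ ae volume) (𝓝 c) := by
    intro L
    refine exists_trace_real hS ho hne (f := fun x => L (f x)) (g := fun x => L (g x)) ?_ ?_ ?_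
    · intro x
      obtain ⟨s, hs, hi⟩ := hf x
      exact ⟨s, hs, L.integrable_comp hi⟩
    · intro x
      obtain ⟨s, hs, hi⟩ := hg x
      exact ⟨s, hs, L.integrable_comp hi⟩
    · intro φ hφ
      have e := congrArg L (h φ ⟨hφ.1, hφ.2.1, hφ.2.2.trans h0⟩)
      rw [map_neg, ← L.integral_comp_comm (test _ hφ.deriv).1,
        ← L.integral_comp_comm (test _ hφ).2] at e
      simpa only [map_smul, smul_eq_mul] using e
  obtain ⟨c, hc⟩ := part Complex.reCLM
  obtain ⟨d, hd⟩ := part Complex.imCLM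
  refine ⟨(c : ℂ) + d * Complex.I, ?_⟩
  have := ((Complex.continuous_ofReal.tendsto c).comp hc).add
    (((Complex.continuous_ofReal.tendsto d).comp hd).mul_const Complex.I)
  refine this.congr fun x => ?_
  simp [Complex.re_add_im]

theorem HasWeakDeriv.exists_right {f g : L2R} (h : HasWeakDeriv f g) :
    ∃ c, Tendsto (f : ℝ → ℂ) rightOfZero (𝓝 c) :=
  h.exists_trace Set.ordConnected_Ioi isOpen_Ioi ⟨1, by simp⟩ (fun x hx => (ne_of_gt hx))

theorem HasWeakDeriv.exists_left {f g : L2R} (h : HasWeakDeriv f g) :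
    ∃ c, Tendsto (f : ℝ → ℂ) leftOfZero (𝓝 c) :=
  h.exists_trace Set.ordConnected_Iio isOpen_Iio ⟨-1, by simp⟩ (fun x hx => (ne_of_lt hx))

instance : NeBot rightOfZero := by
  refine inf_neBot_iff.2 fun {s} hs {t} ht => ?_
  obtain ⟨u, hu, hus⟩ := mem_nhdsGT_iff_exists_Ioo_subset.1 hs
  have hpos : volume (Set.Ioo (0 : ℝ) u) ≠ 0 := by simpa using hu
  by_contra hc
  rw [Set.not_nonempty_iff_eq_empty, ← Set.disjoint_iff_inter_eq_empty] at hc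
  exact hpos (measure_mono_null (fun x hx hxt => Set.disjoint_left.1 hc (hus hx) hxt)
    (mem_ae_iff.1 ht))

instance : NeBot leftOfZero := by
  refine inf_neBot_iff.2 fun {s} hs {t} ht => ?_
  obtain ⟨u, hu, hus⟩ := mem_nhdsLT_iff_exists_Ioo_subset.1 hs
  have hpos : volume (Set.Ioo u (0 : ℝ)) ≠ 0 := by simpa using hu
  by_contra hc
  rw [Set.not_nonempty_iff_eq_empty, ← Set.disjoint_iff_inter_eq_empty] at hc
  exact hpos (measure_mono_null (fun x hx hxt => Set.disjoint_left.1 hc (hus hx) hxt)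
    (mem_ae_iff.1 ht))

theorem HasWeakDeriv.tendsto_right {f g : L2R} (h : HasWeakDeriv f g) :
    Tendsto (f : ℝ → ℂ) rightOfZero (𝓝 (valRight f)) :=
  tendsto_nhds_limUnder h.exists_right

theorem HasWeakDeriv.tendsto_left {f g : L2R} (h : HasWeakDeriv f g) :
    Tendsto (f : ℝ → ℂ) leftOfZero (𝓝 (valLeft f)) :=
  tendsto_nhds_limUnder h.exists_left

/-! ### Linearity and uniqueness -/

theorem HasWeakDeriv.zero : HasWeakDeriv 0 0 := by
  intro φ _
  have e : ∀ u : ℝ → ℝ, ∫ x, u x • (0 : L2R) x = 0 := by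
    intro u
    rw [← integral_zero ℝ ℂ (μ := volume)]
    refine integral_congr_ae ?_
    filter_upwards [Lp.coeFn_zero ℂ 2 (volume : Measure ℝ)] with x hx
    rw [hx]; simp
  rw [e, e, neg_zero]

theorem L2R.integrable_test {S : Set ℝ} {φ : ℝ → ℝ} (hφ : IsTestOn S φ) (f : L2R) :
    Integrable (fun x => φ x • f x) :=
  (L2R.locallyIntegrable f).integrable_smul_left_of_hasCompactSupport hφ.1.continuous hφ.2.1

theorem HasWeakDeriv.add {f g f' g' : L2R} (h : HasWeakDeriv f f') (k : HasWeakDeriv g g') :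
    HasWeakDeriv (f + g) (f' + g') := by
  intro φ hφ
  have e : ∀ u, IsTestOn {0}ᶜ u → ∀ a b : L2R,
      ∫ x, u x • (a + b) x = (∫ x, u x • a x) + ∫ x, u x • b x := by
    intro u hu a b
    rw [← integral_add (L2R.integrable_test hu a) (L2R.integrable_test hu b)]
    refine integral_congr_ae ?_
    filter_upwards [Lp.coeFn_add a b] with x hx
    rw [hx, Pi.add_apply, smul_add]
  rw [e _ hφ.deriv, e _ hφ, h φ hφ, k φ hφ]
  ring

theorem HasWeakDeriv.smul {f f' : L2R} (c : ℂ) (h : HasWeakDeriv f f') :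
    HasWeakDeriv (c • f) (c • f') := by
  intro φ hφ
  have e : ∀ u : ℝ → ℝ, ∀ a : L2R, ∫ x, u x • (c • a) x = c * ∫ x, u x • a x := by
    intro u a
    rw [← integral_const_mul]
    refine integral_congr_ae ?_
    filter_upwards [Lp.coeFn_smul c a] with x hx
    rw [hx]; simp [mul_left_comm]
  rw [e, e, h φ hφ]
  ring

theorem HasWeakDeriv.unique {f g g' : L2R} (h : HasWeakDeriv f g) (k : HasWeakDeriv f g') :
    g = g' := by
  have key := (isOpen_compl_singleton (x := (0 : ℝ))).ae_eq_zero_of_integral_contDiff_smul_eq_zero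
    (μ := volume) (f := fun x => g x - g' x)
    (((L2R.locallyIntegrable g).sub (L2R.locallyIntegrable g')).locallyIntegrableOn _) (by
      intro φ h1 h2 h3
      have hφ : IsTestOn {0}ᶜ φ := ⟨h1, h2, h3⟩
      simp_rw [smul_sub]
      rw [integral_sub (L2R.integrable_test hφ g) (L2R.integrable_test hφ g')]
      have := (h φ hφ).symm.trans (k φ hφ)
      rw [neg_inj.1 this, sub_self])
  refine Lp.ext ?_
  filter_upwards [key, Measure.ae_ne volume (0 : ℝ)] with x hx h0
  exact sub_eq_zero.1 (hx h0)

/-- The weak derivative on `ℝ \ {0}` of an element of `L₂(ℝ)` that has one in `L₂(ℝ)`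
(and `0` for the other elements, which never occur below). -/
def weakDeriv (f : L2R) : L2R :=
  open Classical in if h : ∃ g, HasWeakDeriv f g then h.choose else 0

theorem HasWeakDeriv.weakDeriv_eq {f g : L2R} (h : HasWeakDeriv f g) : weakDeriv f = g := by
  have hex : ∃ g, HasWeakDeriv f g := ⟨g, h⟩
  rw [weakDeriv, dif_pos hex]
  exact hex.choose_spec.unique h

theorem HasWeakDeriv.valRight_add {f g f' g' : L2R} (h : HasWeakDeriv f f')
    (k : HasWeakDeriv g g') : valRight (f + g) = valRight f + valRight g := by
  refine tendsto_nhds_unique (h.add k).tendsto_right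
    ((h.tendsto_right.add k.tendsto_right).congr' ?_)
  exact (inf_le_right : rightOfZero ≤ ae volume) (Lp.coeFn_add f g).symm

theorem HasWeakDeriv.valLeft_add {f g f' g' : L2R} (h : HasWeakDeriv f f')
    (k : HasWeakDeriv g g') : valLeft (f + g) = valLeft f + valLeft g := by
  refine tendsto_nhds_unique (h.add k).tendsto_left
    ((h.tendsto_left.add k.tendsto_left).congr' ?_)
  exact (inf_le_right : leftOfZero ≤ ae volume) (Lp.coeFn_add f g).symm

theorem HasWeakDeriv.valRight_smul {f f' : L2R} (c : ℂ) (h : HasWeakDeriv f f') :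
    valRight (c • f) = c * valRight f := by
  refine tendsto_nhds_unique (h.smul c).tendsto_right ((h.tendsto_right.const_mul c).congr' ?_)
  exact (inf_le_right : rightOfZero ≤ ae volume) (Lp.coeFn_smul c f).symm

theorem HasWeakDeriv.valLeft_smul {f f' : L2R} (c : ℂ) (h : HasWeakDeriv f f') :
    valLeft (c • f) = c * valLeft f := by
  refine tendsto_nhds_unique (h.smul c).tendsto_left ((h.tendsto_left.const_mul c).congr' ?_)
  exact (inf_le_right : leftOfZero ≤ ae volume) (Lp.coeFn_smul c f).symm

/-! ### The space `W₂²(ℝ \ {0})`, boundary maps and the operators -/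

/-- The Sobolev space `W₂²(ℝ \ {0})`: elements of `L₂(ℝ)` whose first and second weak derivatives
on `ℝ \ {0}` lie in `L₂(ℝ)`. -/
def W22 : Submodule ℂ L2R where
  carrier := {f | ∃ f' f'' : L2R, HasWeakDeriv f f' ∧ HasWeakDeriv f' f''}
  zero_mem' := ⟨0, 0, .zero, .zero⟩
  add_mem' := by
    rintro f g ⟨f', f'', h1, h2⟩ ⟨g', g'', k1, k2⟩
    exact ⟨f' + g', f'' + g'', h1.add k1, h2.add k2⟩
  smul_mem' := by
    rintro c f ⟨f', f'', h1, h2⟩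
    exact ⟨c • f', c • f'', h1.smul c, h2.smul c⟩

theorem W22.spec {f : L2R} (hf : f ∈ W22) : HasWeakDeriv f (weakDeriv f) ∧
    HasWeakDeriv (weakDeriv f) (weakDeriv (weakDeriv f)) := by
  obtain ⟨f', f'', h1, h2⟩ := hf
  rw [h1.weakDeriv_eq, h2.weakDeriv_eq]
  exact ⟨h1, h2⟩

/-- Differentiation on `W₂²(ℝ \ {0})`, pointwise off `0`. -/
def D1 : W22 →ₗ[ℂ] L2R where
  toFun f := weakDeriv f
  map_add' f g := ((W22.spec f.2).1.add (W22.spec g.2).1).weakDeriv_eq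
  map_smul' c f := ((W22.spec f.2).1.smul c).weakDeriv_eq

/-- The second derivative `{f''(x)}_{x ≠ 0}` on `W₂²(ℝ \ {0})`. -/
def D2 : W22 →ₗ[ℂ] L2R where
  toFun f := weakDeriv (D1 f)
  map_add' f g := by
    rw [map_add]; exact ((W22.spec f.2).2.add (W22.spec g.2).2).weakDeriv_eq
  map_smul' c f := by
    rw [map_smul]; exact ((W22.spec f.2).2.smul c).weakDeriv_eq

/-- `f(0+)` on `W₂²(ℝ \ {0})`. -/
def plus : W22 →ₗ[ℂ] ℂ where
  toFun f := valRight f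
  map_add' f g := (W22.spec f.2).1.valRight_add (W22.spec g.2).1
  map_smul' c f := (W22.spec f.2).1.valRight_smul c

/-- `f(0-)` on `W₂²(ℝ \ {0})`. -/
def minus : W22 →ₗ[ℂ] ℂ where
  toFun f := valLeft f
  map_add' f g := (W22.spec f.2).1.valLeft_add (W22.spec g.2).1
  map_smul' c f := (W22.spec f.2).1.valLeft_smul c

/-- `f'(0+)` on `W₂²(ℝ \ {0})`. -/
def dplus : W22 →ₗ[ℂ] ℂ where
  toFun f := valRight (D1 f)
  map_add' f g := by
    rw [map_add]; exact (W22.spec f.2).2.valRight_add (W22.spec g.2).2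
  map_smul' c f := by
    rw [map_smul]; exact (W22.spec f.2).2.valRight_smul c

/-- `f'(0-)` on `W₂²(ℝ \ {0})`. -/
def dminus : W22 →ₗ[ℂ] ℂ where
  toFun f := valLeft (D1 f)
  map_add' f g := by
    rw [map_add]; exact (W22.spec f.2).2.valLeft_add (W22.spec g.2).2
  map_smul' c f := by
    rw [map_smul]; exact (W22.spec f.2).2.valLeft_smul c

/-- The mean value `f_r(0) = (f(0+) + f(0-)) / 2`. -/
def meanVal : W22 →ₗ[ℂ] ℂ := (2⁻¹ : ℂ) • (plus + minus)

/-- The mean derivative `f_r'(0) = (f'(0+) + f'(0-)) / 2`. -/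
def meanDeriv : W22 →ₗ[ℂ] ℂ := (2⁻¹ : ℂ) • (dplus + dminus)

/-- The jump `f_s(0) = f(0+) - f(0-)`. -/
def jumpVal : W22 →ₗ[ℂ] ℂ := plus - minus

/-- The jump `f_s'(0) = f'(0+) - f'(0-)`. -/
def jumpDeriv : W22 →ₗ[ℂ] ℂ := dplus - dminus

/-- `Γ₀ f = (f_r(0), -f_r'(0))`. -/
def Gamma0 : W22 →ₗ[ℂ] (Fin 2 → ℂ) := LinearMap.pi ![meanVal, -meanDeriv]

/-- `Γ₁ f = (f_s'(0) - (q₁, f), f_s(0) - (q₂, f))`. -/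
def Gamma1 (q₁ q₂ : L2R) : W22 →ₗ[ℂ] (Fin 2 → ℂ) :=
  LinearMap.pi ![jumpDeriv - (innerSL ℂ q₁).toLinearMap ∘ₗ W22.subtype,
    jumpVal - (innerSL ℂ q₂).toLinearMap ∘ₗ W22.subtype]

/-- The maximal operator `S_max f = -f'' + f_r(0) q₁ - f_r'(0) q₂` with domain `W₂²(ℝ \ {0})`. -/
def Smax (q₁ q₂ : L2R) : L2R →ₗ.[ℂ] L2R where
  domain := W22
  toFun := -D2 + meanVal.smulRight q₁ - meanDeriv.smulRight q₂

/-- The operator `H_T`: the restriction of `S_max` to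
`{f ∈ W₂²(ℝ \ {0}) : T Γ₀ f - Γ₁ f = 0}`. -/
def HT (T : Matrix (Fin 2) (Fin 2) ℂ) (q₁ q₂ : L2R) : L2R →ₗ.[ℂ] L2R :=
  (Smax q₁ q₂).domRestrict
    ((LinearMap.ker (T.mulVecLin ∘ₗ Gamma0 - Gamma1 q₁ q₂)).map W22.subtype)

/-- The space parity operator `(P f)(x) = f(-x)` on `L₂(ℝ)`. -/
def parity : L2R →ₗ[ℂ] L2R :=
  Lp.compMeasurePreservingₗ ℂ (fun x : ℝ => -x) (Measure.measurePreserving_neg volume)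

/-- The product `A B` of an unbounded operator `A` and an everywhere defined operator `B`, with its
natural domain `{f : B f ∈ D(A)}`. -/
def compEverywhere (A : L2R →ₗ.[ℂ] L2R) (B : L2R →ₗ[ℂ] L2R) : L2R →ₗ.[ℂ] L2R where
  domain := A.domain.comap B
  toFun := A.toFun ∘ₗ (B.restrict (p := A.domain.comap B) (q := A.domain) fun _ h => h)

/-- `H` is `P`-self-adjoint: it is densely defined (so that its adjoint `H†` exists) and
`P H = H† P` as unbounded operators, equality of the natural domains included. -/
def IsParitySelfAdjoint (H : L2R →ₗ.[ℂ] L2R) : Prop :=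
  Dense (H.domain : Set L2R) ∧ parity.compPMap H = compEverywhere H.adjoint parity

end NonlocalPoint

end

open MeasureTheory Filter Topology
open scoped ContDiff ComplexConjugate

noncomputable section

namespace NonlocalPoint

/-! ### Parity -/

/-! The core is that the adjoint of `H_T` is `H_{T†}`, with the same `q₁`, `q₂` and the conjugate
transpose of `T`. Green's formula reads `(S_max g, f) - (g, S_max f) = (Γ₁ g, Γ₀ f) - (Γ₀ g, Γ₁ f)`,
and the right side vanishes when `Γ₁ f = T Γ₀ f` and `Γ₁ g = T† Γ₀ g` (`inner_maxOp`).

Conversely, let `(h, f) = (g, H_T f)` for all `f` in the domain (`boundary_of_weak_adjoint`). The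
difference of the two sides, as a functional on `W22`, kills the kernel of `T Γ₀ - Γ₁`, so it
factors through that map into `ℂ²`. Test functions off `0` show that `g` has a second weak
derivative in `L₂`, hence also a first one (`exists_hasWeakDeriv_of_second`). Functions with
prescribed traces (`exists_traces`) then yield the boundary condition for `T†`. The case `g = 0`
gives density.

Parity sends the boundary condition of `T` to that of `T` with off-diagonal entries negated and
commutes with the maximal action (`Boundary.parityW`, `maxOp_parityW`). The assumptions on `a, b, c,
d` say that this negated matrix is `T†`. -/

theorem parity_coe (f : L2R) : (parity f : ℝ → ℂ) =ᵐ[volume] fun x => f (-x) :=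
  Lp.coeFn_compMeasurePreserving f (Measure.measurePreserving_neg volume)

theorem ae_comp_neg {p : ℝ → Prop} (h : ∀ᵐ x, p x) : ∀ᵐ x : ℝ, p (-x) :=
  (Measure.measurePreserving_neg (volume : Measure ℝ)).quasiMeasurePreserving.ae h

theorem parity_parity (f : L2R) : parity (parity f) = f := by
  refine Lp.ext ?_
  filter_upwards [parity_coe (parity f), ae_comp_neg (parity_coe f)] with x h1 h2
  rw [h1, h2, neg_neg]

theorem inner_eq_integral (f g : L2R) : inner ℂ f g = ∫ x, conj (f x) * g x := by
  rw [L2.inner_def]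
  exact integral_congr_ae (Eventually.of_forall fun x => by simp [mul_comm])

theorem inner_parity (f g : L2R) : inner ℂ (parity f) g = inner ℂ f (parity g) := by
  rw [inner_eq_integral, inner_eq_integral, ← integral_neg_eq_self]
  refine integral_congr_ae ?_
  filter_upwards [ae_comp_neg (parity_coe f), parity_coe g] with x h1 h2
  rw [h1, h2, neg_neg]

theorem IsTestOn.comp_neg {S T : Set ℝ} (hST : ∀ x, -x ∈ S → x ∈ T) {φ : ℝ → ℝ}
    (h : IsTestOn S φ) : IsTestOn T (fun x => φ (-x)) := by
  refine ⟨h.1.comp contDiff_neg, h.2.1.comp_homeomorph (Homeomorph.neg ℝ), ?_⟩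
  have : tsupport (fun x => φ (-x)) = (Homeomorph.neg ℝ) ⁻¹' tsupport φ :=
    tsupport_comp_eq_preimage φ (Homeomorph.neg ℝ)
  rw [this]
  exact fun x hx => hST x (h.2.2 hx)

theorem integral_smul_parity (u : ℝ → ℝ) (f : L2R) :
    ∫ x, u x • parity f x = ∫ x, u (-x) • f x := by
  rw [← integral_neg_eq_self]
  refine integral_congr_ae ?_
  filter_upwards [ae_comp_neg (parity_coe f)] with x h1
  rw [h1, neg_neg]

theorem integral_smul_neg (u : ℝ → ℝ) (f : L2R) :
    ∫ x, u x • (-f) x = - ∫ x, u x • f x := by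
  rw [← integral_neg]
  refine integral_congr_ae ?_
  filter_upwards [Lp.coeFn_neg f] with x h1
  rw [h1, Pi.neg_apply, smul_neg]

theorem HasWeakDeriv.parity {f g : L2R} (h : HasWeakDeriv f g) :
    HasWeakDeriv (parity f) (-parity g) := by
  intro φ hφ
  have hψ : IsTestOn {0}ᶜ (fun x => φ (-x)) := hφ.comp_neg (by simp)
  have e := h _ hψ
  rw [integral_smul_neg, integral_smul_parity, integral_smul_parity, neg_neg]
  simp_rw [deriv_comp_neg, neg_smul] at e
  rw [integral_neg, neg_inj] at e
  exact e

theorem map_neg_rightOfZero : map (fun x : ℝ => -x) rightOfZero = leftOfZero := by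
  unfold rightOfZero leftOfZero
  rw [Filter.map_inf neg_injective]
  congr 1
  · simp
  · have := (MeasurableEquiv.neg ℝ).map_ae volume
    have e : Measure.map (MeasurableEquiv.neg ℝ) volume = volume :=
      (Measure.measurePreserving_neg (volume : Measure ℝ)).map_eq
    rw [e] at this
    exact this

/-- No limit has to exist: both sides are `limUnder` of the same pushed-forward filter. -/
theorem valRight_parity (f : L2R) : valRight (parity f) = valLeft f := by
  unfold valRight valLeft limUnder
  rw [← map_neg_rightOfZero, map_map]
  congr 1
  exact map_congr ((inf_le_right : rightOfZero ≤ ae volume) (parity_coe f))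

theorem valLeft_parity (f : L2R) : valLeft (parity f) = valRight f := by
  rw [← valRight_parity, parity_parity]

/-! ### Integration by parts on a half-line -/

/-- `f` minus the primitive of `g` has zero weak derivative on `S`, so it is a.e. constant there. -/
theorem ae_eq_primitive_real {S : Set ℝ} (hS : S.OrdConnected) (ho : IsOpen S)
    (hne : S.Nonempty) {f g : ℝ → ℝ} (hf : LocallyIntegrable f volume)
    (hg : LocallyIntegrable g volume)
    (h : ∀ φ, IsTestOn S φ → ∫ x, deriv φ x * f x = - ∫ x, φ x * g x) :
    ∃ c : ℝ, ∀ᵐ x, x ∈ S → f x = c + ∫ t in (0 : ℝ)..x, g t := by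
  have hF : Continuous (fun x => ∫ t in (0 : ℝ)..x, g t) :=
    intervalIntegral.continuous_primitive (intervalIntegrable_of_loc hg) 0
  obtain ⟨c, hc⟩ := ae_const_of_weakDeriv_zero hS ho hne
    (f := fun x => f x - ∫ t in (0 : ℝ)..x, g t) (hf.sub hF.locallyIntegrable) (by
      intro φ hφ
      simp_rw [mul_sub]
      rw [integral_sub (hφ.deriv.integrable_smul hf)
        (hφ.deriv.integrable_smul hF.locallyIntegrable), h φ hφ,
        hφ.integral_deriv_mul_primitive hg, sub_self])
  refine ⟨c, ?_⟩
  filter_upwards [hc] with x hx hxS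
  rw [← hx hxS]; ring

theorem L2R.intervalIntegrable (f : L2R) (a b : ℝ) : IntervalIntegrable (f : ℝ → ℂ) volume a b :=
  (intervalIntegrable_iff').2 ((L2R.locallyIntegrable f).integrableOn_isCompact isCompact_uIcc)

theorem L2R.locallyIntegrable_comp (f : L2R) (L : ℂ →L[ℝ] ℝ) :
    LocallyIntegrable (fun x => L (f x)) volume := by
  intro x
  obtain ⟨s, hs, hi⟩ := L2R.locallyIntegrable f x
  exact ⟨s, hs, L.integrable_comp hi⟩

/-- An element of `L₂(ℝ)` with a weak derivative agrees on `(0, ∞)` with a primitive of that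
derivative. -/
theorem HasWeakDeriv.ae_eq_primitive {f g : L2R} (h : HasWeakDeriv f g) :
    ∀ᵐ x, x ∈ Set.Ioi (0 : ℝ) → f x = valRight f + ∫ t in (0 : ℝ)..x, g t := by
  have part : ∀ L : ℂ →L[ℝ] ℝ, ∃ c : ℝ,
      ∀ᵐ x, x ∈ Set.Ioi (0 : ℝ) → L (f x) = c + ∫ t in (0 : ℝ)..x, L (g t) := by
    intro L
    refine ae_eq_primitive_real Set.ordConnected_Ioi isOpen_Ioi ⟨1, by simp⟩
      (L2R.locallyIntegrable_comp f L) (L2R.locallyIntegrable_comp g L) ?_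
    intro φ hφ
    have hφ0 : IsTestOn {0}ᶜ φ := ⟨hφ.1, hφ.2.1, hφ.2.2.trans fun x hx => ne_of_gt hx⟩
    have e := congrArg L (h φ hφ0)
    rw [map_neg, ← L.integral_comp_comm (L2R.integrable_test hφ0.deriv f),
      ← L.integral_comp_comm (L2R.integrable_test hφ0 g)] at e
    simpa only [map_smul, smul_eq_mul] using e
  obtain ⟨c, hc⟩ := part Complex.reCLM
  obtain ⟨d, hd⟩ := part Complex.imCLM
  have key : ∀ᵐ x, x ∈ Set.Ioi (0 : ℝ) → f x = (⟨c, d⟩ : ℂ) + ∫ t in (0 : ℝ)..x, g t := by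
    filter_upwards [hc, hd] with x h1 h2 hx
    specialize h1 hx
    specialize h2 hx
    rw [Complex.reCLM.intervalIntegral_comp_comm (L2R.intervalIntegrable g 0 x)] at h1
    rw [Complex.imCLM.intervalIntegral_comp_comm (L2R.intervalIntegrable g 0 x)] at h2
    exact Complex.ext (by simpa using h1) (by simpa using h2)
  have hcont : Continuous fun x => (⟨c, d⟩ : ℂ) + ∫ t in (0 : ℝ)..x, g t :=
    continuous_const.add (intervalIntegral.continuous_primitive (L2R.intervalIntegrable g) 0)
  -- The primitive vanishes at `0`, so the constant must be the right trace.
  have ht : Tendsto (f : ℝ → ℂ) rightOfZero (𝓝 ⟨c, d⟩) := by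
    have h0 : Tendsto (fun x => (⟨c, d⟩ : ℂ) + ∫ t in (0 : ℝ)..x, g t) rightOfZero
        (𝓝 ⟨c, d⟩) := by
      have := hcont.tendsto 0
      simp only [intervalIntegral.integral_same, add_zero] at this
      exact this.mono_left (inf_le_left.trans nhdsWithin_le_nhds)
    refine h0.congr' ?_
    have h1 : ∀ᶠ x in rightOfZero, x ∈ Set.Ioi (0 : ℝ) :=
      inf_le_left (a := 𝓝[>] (0 : ℝ)) self_mem_nhdsWithin
    have h2 := (inf_le_right : rightOfZero ≤ ae volume) key
    filter_upwards [h1, h2] with x hx hx'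
    exact (hx' hx).symm
  rw [tendsto_nhds_unique h.tendsto_right ht]
  exact key

/-- Primitives of locally integrable functions are absolutely continuous, so the product rule can be
integrated; Lebesgue differentiation recovers `p` and `q` a.e. -/
theorem integral_mul_primitive_real {p q : ℝ → ℝ} (hp : LocallyIntegrable p volume)
    (hq : LocallyIntegrable q volume) (c d R : ℝ) :
    ∫ x in (0 : ℝ)..R, (p x * (d + ∫ t in (0 : ℝ)..x, q t) + (c + ∫ t in (0 : ℝ)..x, p t) * q x) =
      (c + ∫ t in (0 : ℝ)..R, p t) * (d + ∫ t in (0 : ℝ)..R, q t) - c * d := by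
  have ac : ∀ {r : ℝ → ℝ}, LocallyIntegrable r volume → ∀ e : ℝ,
      AbsolutelyContinuousOnInterval (fun x => e + ∫ t in (0 : ℝ)..x, r t) 0 R := by
    intro r hr e
    have h1 : AbsolutelyContinuousOnInterval (fun _ : ℝ => e) 0 R :=
      ContDiffOn.absolutelyContinuousOnInterval contDiffOn_const
    exact h1.add ((intervalIntegrable_of_loc hr 0
      R).absolutelyContinuousOnInterval_intervalIntegral (by simp))
  have key := (ac hp c).integral_deriv_mul_eq_sub (ac hq d)
  simp only [intervalIntegral.integral_same, add_zero] at key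
  rw [← key]
  apply intervalIntegral.integral_congr_ae
  filter_upwards [LocallyIntegrable.ae_hasDerivAt_integral hp,
    LocallyIntegrable.ae_hasDerivAt_integral hq] with x h1 h2 _
  rw [((h1 0).const_add c).deriv, ((h2 0).const_add d).deriv]

/-- Reduction to the real case: the real part of `conj z * w` is `re re + im im`, the imaginary part
`re im - im re`. -/
theorem integral_conj_mul_primitive (p q : L2R) (c d : ℂ) (R : ℝ) :
    ∫ x in (0 : ℝ)..R, (conj (p x) * (d + ∫ t in (0 : ℝ)..x, q t) +
        conj (c + ∫ t in (0 : ℝ)..x, p t) * q x) =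
      conj (c + ∫ t in (0 : ℝ)..R, p t) * (d + ∫ t in (0 : ℝ)..R, q t) - conj c * d := by
  have cont : ∀ (r : L2R) (e : ℂ), Continuous fun x => e + ∫ t in (0 : ℝ)..x, r t := fun r e =>
    continuous_const.add (intervalIntegral.continuous_primitive (L2R.intervalIntegrable r) 0)
  have rint : ∀ (r : L2R) (L : ℂ →L[ℝ] ℝ) (x : ℝ),
      ∫ t in (0 : ℝ)..x, L (r t) = L (∫ t in (0 : ℝ)..x, r t) := fun r L x =>
    L.intervalIntegral_comp_comm (L2R.intervalIntegrable r 0 x)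
  have rcont : ∀ (r : L2R) (L : ℂ →L[ℝ] ℝ) (e : ℝ),
      Continuous fun x => e + ∫ t in (0 : ℝ)..x, L (r t) := fun r L e =>
    continuous_const.add (intervalIntegral.continuous_primitive
      (intervalIntegrable_of_loc (L2R.locallyIntegrable_comp r L)) 0)
  have ri : ∀ (r s : L2R) (L M : ℂ →L[ℝ] ℝ) (e f : ℝ), IntervalIntegrable
      (fun x => L (r x) * (f + ∫ t in (0 : ℝ)..x, M (s t)) +
        (e + ∫ t in (0 : ℝ)..x, L (r t)) * M (s x)) volume 0 R := fun r s L M e f =>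
    ((intervalIntegrable_of_loc (L2R.locallyIntegrable_comp r L) 0 R).mul_continuousOn
      (rcont s M f).continuousOn).add
    ((intervalIntegrable_of_loc (L2R.locallyIntegrable_comp s M) 0 R).continuousOn_mul
      (rcont r L e).continuousOn)
  have conjInt : IntervalIntegrable (fun x => conj (p x)) volume 0 R :=
    (intervalIntegrable_iff.2 (Complex.conjCLE.toContinuousLinearMap.integrable_comp
      (intervalIntegrable_iff.1 (L2R.intervalIntegrable p 0 R))))
  have hi : IntervalIntegrable (fun x => conj (p x) * (d + ∫ t in (0 : ℝ)..x, q t) +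
        conj (c + ∫ t in (0 : ℝ)..x, p t) * q x) volume 0 R :=
    (conjInt.mul_continuousOn (cont q d).continuousOn).add
    ((L2R.intervalIntegrable q 0 R).continuousOn_mul
      (Complex.continuous_conj.comp (cont p c)).continuousOn)
  have main : ∀ (L M : ℂ →L[ℝ] ℝ),
      ∫ x in (0 : ℝ)..R, (L (p x) * (M d + ∫ t in (0 : ℝ)..x, M (q t)) +
        (L c + ∫ t in (0 : ℝ)..x, L (p t)) * M (q x)) =
      (L c + ∫ t in (0 : ℝ)..R, L (p t)) * (M d + ∫ t in (0 : ℝ)..R, M (q t)) - L c * M d :=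
    fun L M => integral_mul_primitive_real (L2R.locallyIntegrable_comp p L)
      (L2R.locallyIntegrable_comp q M) _ _ _
  apply Complex.ext
  · have e1 := congrArg₂ (· + ·) (main Complex.reCLM Complex.reCLM)
      (main Complex.imCLM Complex.imCLM)
    rw [← intervalIntegral.integral_add (ri _ _ _ _ _ _) (ri _ _ _ _ _ _)] at e1
    have e2 := Complex.reCLM.intervalIntegral_comp_comm hi
    rw [Complex.reCLM_apply] at e2
    rw [← e2]
    simp only [rint] at e1
    simp only [Complex.reCLM_apply, Complex.imCLM_apply, Complex.add_re, Complex.mul_re,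
      Complex.conj_re, Complex.conj_im, Complex.sub_re, Complex.add_im] at e1 ⊢
    refine Eq.trans ?_ (e1.trans ?_)
    · congr 1; ext x; ring
    · ring
  · have e1 := congrArg₂ (· - ·) (main Complex.reCLM Complex.imCLM)
      (main Complex.imCLM Complex.reCLM)
    rw [← intervalIntegral.integral_sub (ri _ _ _ _ _ _) (ri _ _ _ _ _ _)] at e1
    have e2 := Complex.imCLM.intervalIntegral_comp_comm hi
    rw [Complex.imCLM_apply] at e2
    rw [← e2]
    simp only [rint] at e1
    simp only [Complex.reCLM_apply, Complex.imCLM_apply, Complex.add_im, Complex.mul_im,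
      Complex.conj_re, Complex.conj_im, Complex.sub_im, Complex.add_re] at e1 ⊢
    refine Eq.trans ?_ (e1.trans ?_)
    · congr 1; ext x; ring
    · ring

theorem L2R.integrable_conj_mul (f g : L2R) : Integrable (fun x => conj (f x) * g x) := by
  have := L2.integrable_inner (𝕜 := ℂ) f g
  refine this.congr (Eventually.of_forall fun x => ?_)
  simp [mul_comm]

/-- Integration by parts on `(0, R)` shows that `conj F * G` has a limit at infinity. It is also
integrable there, being a.e. equal to `conj f * g`, so the limit is `0` and only the trace term at
`0` remains. -/
theorem HasWeakDeriv.integral_Ioi {f f' g g' : L2R} (hf : HasWeakDeriv f f')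
    (hg : HasWeakDeriv g g') :
    ∫ x in Set.Ioi (0 : ℝ), (conj (f' x) * g x + conj (f x) * g' x) =
      -(conj (valRight f) * valRight g) := by
  set F : ℝ → ℂ := fun x => valRight f + ∫ t in (0 : ℝ)..x, f' t with hF
  set G : ℝ → ℂ := fun x => valRight g + ∫ t in (0 : ℝ)..x, g' t with hG
  have hi : IntegrableOn (fun x => conj (f' x) * g x + conj (f x) * g' x) (Set.Ioi 0) :=
    ((L2R.integrable_conj_mul f' g).add (L2R.integrable_conj_mul f g')).integrableOn
  have lim1 := intervalIntegral_tendsto_integral_Ioi 0 hi tendsto_id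
  have e : ∀ R : ℝ, 0 ≤ R → ∫ x in (0 : ℝ)..R, (conj (f' x) * g x + conj (f x) * g' x) =
      conj (F R) * G R - conj (valRight f) * valRight g := by
    intro R hR
    rw [← integral_conj_mul_primitive]
    apply intervalIntegral.integral_congr_ae
    filter_upwards [hf.ae_eq_primitive, hg.ae_eq_primitive] with x h1 h2 hx
    rw [Set.uIoc_of_le hR] at hx
    rw [h1 hx.1, h2 hx.1]
  have lim2 : Tendsto (fun R => conj (F R) * G R) atTop
      (𝓝 ((∫ x in Set.Ioi (0 : ℝ), (conj (f' x) * g x + conj (f x) * g' x)) +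
        conj (valRight f) * valRight g)) := by
    refine (lim1.add_const _).congr' ?_
    filter_upwards [eventually_ge_atTop 0] with R hR
    rw [id, e R hR]; ring
  have hFG : IntegrableAtFilter (fun R => conj (F R) * G R) atTop := by
    refine ⟨Set.Ioi 0, Ioi_mem_atTop _, ?_⟩
    refine (L2R.integrable_conj_mul f g).integrableOn.congr ?_
    rw [EventuallyEq, ae_restrict_iff' measurableSet_Ioi]
    filter_upwards [hf.ae_eq_primitive, hg.ae_eq_primitive] with x h1 h2 hx
    rw [h1 hx, h2 hx]
  -- A nonzero limit is excluded because every neighbourhood of `+∞` has infinite measure.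
  have := hFG.eq_zero_of_tendsto (by
    intro s hs
    rcases mem_atTop_sets.1 hs with ⟨b, hb⟩
    rw [← top_le_iff, ← Real.volume_Ici (a := b)]
    exact measure_mono hb) lim2
  exact eq_neg_of_add_eq_zero_left this

/-- Reflection of the formula on `(0, ∞)`; both derivatives change sign under parity, which flips
the sign of the trace term. -/
theorem HasWeakDeriv.integral_Iio {f f' g g' : L2R} (hf : HasWeakDeriv f f')
    (hg : HasWeakDeriv g g') :
    ∫ x in Set.Iio (0 : ℝ), (conj (f' x) * g x + conj (f x) * g' x) =
      conj (valLeft f) * valLeft g := by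
  have h := hf.parity.integral_Ioi hg.parity
  rw [valRight_parity, valRight_parity] at h
  rw [← neg_inj, ← h, ← integral_indicator measurableSet_Iio, ← integral_indicator measurableSet_Ioi,
    ← integral_neg_eq_self, ← integral_neg]
  refine integral_congr_ae ?_
  filter_upwards [parity_coe f, parity_coe g, parity_coe f', parity_coe g',
    Lp.coeFn_neg (NonlocalPoint.parity f'), Lp.coeFn_neg (NonlocalPoint.parity g')]
    with x h1 h2 h3 h4 h5 h6
  by_cases hx : 0 < x
  · rw [Set.indicator_of_mem (show -x ∈ Set.Iio (0 : ℝ) by simpa using hx),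
      Set.indicator_of_mem (show x ∈ Set.Ioi (0 : ℝ) from hx), h5, h6]
    simp only [Pi.neg_apply, h1, h2, h3, h4, map_neg]
    ring
  · rw [Set.indicator_of_notMem (show -x ∉ Set.Iio (0 : ℝ) by simpa using hx),
      Set.indicator_of_notMem (show x ∉ Set.Ioi (0 : ℝ) from hx), neg_zero]

/-- Integration by parts on `ℝ \ {0}`. -/
theorem HasWeakDeriv.inner_add_inner {f f' g g' : L2R} (hf : HasWeakDeriv f f')
    (hg : HasWeakDeriv g g') :
    inner ℂ f' g + inner ℂ f g' =
      conj (valLeft f) * valLeft g - conj (valRight f) * valRight g := by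
  have hi : Integrable (fun x => conj (f' x) * g x + conj (f x) * g' x) :=
    (L2R.integrable_conj_mul f' g).add (L2R.integrable_conj_mul f g')
  rw [inner_eq_integral, inner_eq_integral,
    ← integral_add (L2R.integrable_conj_mul f' g) (L2R.integrable_conj_mul f g'),
    ← intervalIntegral.integral_Iic_add_Ioi (b := 0) hi.integrableOn hi.integrableOn,
    integral_Iic_eq_integral_Iio, hf.integral_Ioi hg, hf.integral_Iio hg]
  ring

/-! ### Cut-off smooth functions as elements of `L₂(ℝ)` -/

/-- The function `φ 1_S` as an element of `L₂(ℝ)`. -/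
def cut {S : Set ℝ} (hS : MeasurableSet S) {φ : ℝ → ℝ} (hc : Continuous φ)
    (hs : HasCompactSupport φ) : L2R :=
  (((Complex.continuous_ofReal.comp hc).memLp_of_hasCompactSupport (p := 2) (μ := volume)
    (hs.comp_left Complex.ofReal_zero)).indicator hS).toLp _

theorem cut_coe {S : Set ℝ} (hS : MeasurableSet S) {φ : ℝ → ℝ} (hc : Continuous φ)
    (hs : HasCompactSupport φ) :
    (cut hS hc hs : ℝ → ℂ) =ᵐ[volume] S.indicator fun x => (φ x : ℂ) :=
  MemLp.coeFn_toLp _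

theorem integral_smul_cut {S : Set ℝ} (hS : MeasurableSet S) {φ : ℝ → ℝ} (hc : Continuous φ)
    (hs : HasCompactSupport φ) (u : ℝ → ℝ) :
    ∫ x, u x • cut hS hc hs x = ((∫ x in S, u x * φ x : ℝ) : ℂ) := by
  rw [← integral_complex_ofReal, ← integral_indicator hS]
  refine integral_congr_ae ?_
  filter_upwards [cut_coe hS hc hs] with x hx
  rw [hx]
  by_cases h : x ∈ S <;> simp [h]

theorem inner_cut {φ : ℝ → ℝ} (hc : Continuous φ) (hs : HasCompactSupport φ) (f : L2R) :
    inner ℂ (cut MeasurableSet.univ hc hs) f = ∫ x, φ x • f x := by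
  rw [inner_eq_integral]
  refine integral_congr_ae ?_
  filter_upwards [cut_coe MeasurableSet.univ hc hs] with x hx
  rw [hx]
  simp

/-- By the product rule the weak derivative identity says that `(φ η)'` integrates to `0` over `S`.
On `(0, ∞)` this holds because `φ` vanishes at `0`, on `ℝ` by compact support alone. -/
theorem hasWeakDeriv_cut {S : Set ℝ} (hS : MeasurableSet S) {η : ℝ → ℝ} (h1 : ContDiff ℝ ∞ η)
    (h2 : HasCompactSupport η)
    (h3 : ∀ φ, IsTestOn {0}ᶜ φ → ∫ x in S, deriv (fun x => φ x * η x) x = 0) :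
    HasWeakDeriv (cut hS h1.continuous h2)
      (cut hS (contDiff_infty_iff_deriv.1 h1).2.continuous h2.deriv) := by
  intro φ hφ
  have hη' : ContDiff ℝ ∞ (deriv η) := (contDiff_infty_iff_deriv.1 h1).2
  rw [integral_smul_cut, integral_smul_cut, ← Complex.ofReal_neg, Complex.ofReal_inj,
    ← add_eq_zero_iff_eq_neg, ← integral_add, ← h3 φ hφ]
  · refine integral_congr_ae (Eventually.of_forall fun x => ?_)
    exact ((((contDiff_infty_iff_deriv.1 hφ.1).1 x).hasDerivAt.mul
      ((contDiff_infty_iff_deriv.1 h1).1 x).hasDerivAt).deriv).symm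
  · exact ((hφ.deriv.1.continuous.mul h1.continuous).integrable_of_hasCompactSupport
      h2.mul_left).integrableOn
  · exact ((hφ.1.continuous.mul hη'.continuous).integrable_of_hasCompactSupport
      h2.deriv.mul_left).integrableOn

theorem hasWeakDeriv_cut_Ioi {η : ℝ → ℝ} (h1 : ContDiff ℝ ∞ η) (h2 : HasCompactSupport η) :
    HasWeakDeriv (cut measurableSet_Ioi (S := Set.Ioi 0) h1.continuous h2)
      (cut measurableSet_Ioi (S := Set.Ioi 0) (contDiff_infty_iff_deriv.1 h1).2.continuous
        h2.deriv) := by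
  refine hasWeakDeriv_cut _ h1 h2 fun φ hφ => ?_
  rw [HasCompactSupport.integral_Ioi_deriv_eq ((hφ.1.mul h1).of_le (by exact_mod_cast le_top))
    h2.mul_left, image_eq_zero_of_notMem_tsupport (fun h => hφ.2.2 h rfl), zero_mul, neg_zero]

theorem IsTestOn.hasWeakDeriv {S : Set ℝ} {η : ℝ → ℝ} (hη : IsTestOn S η) :
    HasWeakDeriv (cut MeasurableSet.univ hη.1.continuous hη.2.1)
      (cut MeasurableSet.univ hη.deriv.1.continuous hη.deriv.2.1) := by
  refine hasWeakDeriv_cut _ hη.1 hη.2.1 fun φ hφ => ?_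
  have hd : ContDiff ℝ ∞ fun x => φ x * η x := hφ.1.mul hη.1
  have hs : HasCompactSupport fun x => φ x * η x := hη.2.1.mul_left
  rw [setIntegral_univ]
  exact integral_eq_zero_of_hasDerivAt_of_integrable
    (fun x => ((contDiff_infty_iff_deriv.1 hd).1 x).hasDerivAt)
    ((contDiff_infty_iff_deriv.1 hd).2.continuous.integrable_of_hasCompactSupport hs.deriv)
    (hd.continuous.integrable_of_hasCompactSupport hs)

theorem eventually_Ioi_rightOfZero : ∀ᶠ x in rightOfZero, x ∈ Set.Ioi (0 : ℝ) :=
  inf_le_left (a := 𝓝[>] (0 : ℝ)) self_mem_nhdsWithin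

theorem eventually_Iio_leftOfZero : ∀ᶠ x in leftOfZero, x ∈ Set.Iio (0 : ℝ) :=
  inf_le_left (a := 𝓝[<] (0 : ℝ)) self_mem_nhdsWithin

theorem rightOfZero_le_nhds : rightOfZero ≤ 𝓝 0 := inf_le_left.trans nhdsWithin_le_nhds

theorem leftOfZero_le_nhds : leftOfZero ≤ 𝓝 0 := inf_le_left.trans nhdsWithin_le_nhds

theorem valRight_cut {S : Set ℝ} (hS : MeasurableSet S) (hsub : Set.Ioi 0 ⊆ S) {φ : ℝ → ℝ}
    (hc : Continuous φ) (hs : HasCompactSupport φ) : valRight (cut hS hc hs) = φ 0 := by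
  refine Tendsto.limUnder_eq ?_
  refine (((Complex.continuous_ofReal.comp hc).tendsto 0).mono_left rightOfZero_le_nhds).congr' ?_
  filter_upwards [(inf_le_right : rightOfZero ≤ ae volume) (cut_coe hS hc hs),
    eventually_Ioi_rightOfZero] with x h1 h2
  rw [h1, Set.indicator_of_mem (hsub h2)]
  rfl

theorem valLeft_cut_univ {φ : ℝ → ℝ} (hc : Continuous φ) (hs : HasCompactSupport φ) :
    valLeft (cut MeasurableSet.univ hc hs) = φ 0 := by
  refine Tendsto.limUnder_eq ?_
  refine (((Complex.continuous_ofReal.comp hc).tendsto 0).mono_left leftOfZero_le_nhds).congr' ?_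
  filter_upwards [(inf_le_right : leftOfZero ≤ ae volume) (cut_coe MeasurableSet.univ hc hs)]
    with x h1
  rw [h1, Set.indicator_of_mem (Set.mem_univ x)]
  rfl

theorem valLeft_cut_Ioi {φ : ℝ → ℝ} (hc : Continuous φ) (hs : HasCompactSupport φ) :
    valLeft (cut measurableSet_Ioi (S := Set.Ioi 0) hc hs) = 0 := by
  refine Tendsto.limUnder_eq ?_
  refine tendsto_const_nhds.congr' ?_
  filter_upwards [(inf_le_right : leftOfZero ≤ ae volume)
    (cut_coe measurableSet_Ioi (S := Set.Ioi 0) hc hs), eventually_Iio_leftOfZero] with x h1 h2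
  rw [h1, Set.indicator_of_notMem (fun h : x ∈ Set.Ioi 0 => lt_asymm h h2)]

/-! ### Parity on `W₂²(ℝ \ {0})` -/

theorem HasWeakDeriv.neg {f f' : L2R} (h : HasWeakDeriv f f') : HasWeakDeriv (-f) (-f') := by
  simpa using h.smul (-1)

theorem HasWeakDeriv.mem_W22 {f f' f'' : L2R} (h : HasWeakDeriv f f')
    (h' : HasWeakDeriv f' f'') : f ∈ W22 := ⟨f', f'', h, h'⟩

theorem HasWeakDeriv.D1_eq {f f' : L2R} (hf : f ∈ W22) (h : HasWeakDeriv f f') :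
    D1 ⟨f, hf⟩ = f' := h.weakDeriv_eq

theorem HasWeakDeriv.D2_eq {f f' f'' : L2R} (hf : f ∈ W22) (h : HasWeakDeriv f f')
    (h' : HasWeakDeriv f' f'') : D2 ⟨f, hf⟩ = f'' := by
  change weakDeriv (D1 ⟨f, hf⟩) = f''
  rw [h.D1_eq, h'.weakDeriv_eq]

theorem hasWeakDeriv_D1 (f : W22) : HasWeakDeriv f (D1 f) := (W22.spec f.2).1

theorem hasWeakDeriv_D2 (f : W22) : HasWeakDeriv (D1 f) (D2 f) := (W22.spec f.2).2

theorem hasWeakDeriv_neg_parity_D1 (f : W22) :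
    HasWeakDeriv (-parity (D1 f)) (parity (D2 f)) := by
  simpa using (hasWeakDeriv_D2 f).parity.neg

/-- The parity operator on `W₂²(ℝ \ {0})`. -/
def parityW (f : W22) : W22 :=
  ⟨parity f, (hasWeakDeriv_D1 f).parity.mem_W22 (hasWeakDeriv_neg_parity_D1 f)⟩

theorem parityW_coe (f : W22) : (parityW f : L2R) = parity f := rfl

theorem D1_parityW (f : W22) : D1 (parityW f) = -parity (D1 f) :=
  (hasWeakDeriv_D1 f).parity.D1_eq _

theorem D2_parityW (f : W22) : D2 (parityW f) = parity (D2 f) :=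
  (hasWeakDeriv_D1 f).parity.D2_eq _ (hasWeakDeriv_neg_parity_D1 f)

theorem plus_parityW (f : W22) : plus (parityW f) = minus f := valRight_parity f

theorem minus_parityW (f : W22) : minus (parityW f) = plus f := valLeft_parity f

theorem dplus_parityW (f : W22) : dplus (parityW f) = -dminus f := by
  change valRight (D1 (parityW f)) = -valLeft (D1 f)
  rw [D1_parityW, ← neg_one_smul ℂ, (hasWeakDeriv_D2 f).parity.valRight_smul, valRight_parity,
    neg_one_mul]

theorem dminus_parityW (f : W22) : dminus (parityW f) = -dplus f := by
  change valLeft (D1 (parityW f)) = -valRight (D1 f)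
  rw [D1_parityW, ← neg_one_smul ℂ, (hasWeakDeriv_D2 f).parity.valLeft_smul, valLeft_parity,
    neg_one_mul]

/-! ### Surjectivity of the traces -/

theorem exists_right_traces {η : ℝ → ℝ} (h1 : ContDiff ℝ ∞ η) (h2 : HasCompactSupport η) :
    ∃ f : W22, plus f = η 0 ∧ minus f = 0 ∧ dplus f = deriv η 0 ∧ dminus f = 0 := by
  have k1 := hasWeakDeriv_cut_Ioi h1 h2
  have k2 := hasWeakDeriv_cut_Ioi (contDiff_infty_iff_deriv.1 h1).2 h2.deriv
  refine ⟨⟨_, k1.mem_W22 k2⟩, valRight_cut measurableSet_Ioi subset_rfl h1.continuous h2,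
    valLeft_cut_Ioi h1.continuous h2, ?_, ?_⟩
  · change valRight (D1 _) = _
    rw [k1.D1_eq]
    exact valRight_cut _ subset_rfl _ _
  · change valLeft (D1 _) = _
    rw [k1.D1_eq]
    exact valLeft_cut_Ioi _ _

/-- A bump `B` equal to `1` near `0` and the function `x * B x`, both cut off to `(0, ∞)`, realise
the two right traces; their reflections realise the left ones. -/
theorem exists_traces (a b c d : ℂ) :
    ∃ f : W22, plus f = a ∧ minus f = b ∧ dplus f = c ∧ dminus f = d := by
  let B : ContDiffBump (0 : ℝ) := ⟨1, 2, one_pos, one_lt_two⟩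
  have hB : (B : ℝ → ℝ) =ᶠ[𝓝 0] 1 := B.eventuallyEq_one
  have hB0 : B 0 = 1 := hB.eq_of_nhds
  have hB1 : deriv B 0 = 0 := by
    rw [hB.deriv_eq]; simp
  have hd : ContDiff ℝ ∞ B := B.contDiff
  have hx : deriv (fun x : ℝ => x * B x) 0 = 1 := by
    rw [((hasDerivAt_id' (0 : ℝ)).fun_mul
      (((contDiff_infty_iff_deriv.1 hd).1 0).hasDerivAt)).deriv, hB0, hB1]
    simp
  obtain ⟨e, e1, e2, e3, e4⟩ := exists_right_traces hd B.hasCompactSupport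
  obtain ⟨k, k1, k2, k3, k4⟩ := exists_right_traces (contDiff_id.mul hd) B.hasCompactSupport.mul_left
  simp only [id_eq] at k1 k3
  rw [hB0] at e1
  rw [hB1] at e3
  rw [hx, Complex.ofReal_one] at k3
  have k1' : plus k = 0 := by simpa using k1
  -- The minus sign before `d` offsets the sign change of derivatives under reflection.
  refine ⟨a • e + c • k + b • parityW e - d • parityW k, ?_, ?_, ?_, ?_⟩ <;>
    simp [plus_parityW, minus_parityW, dplus_parityW, dminus_parityW, e1, e2, e3, e4, k1', k2, k3,
      k4]

/-- Test functions on `ℝ \ {0}` as elements of `W₂²(ℝ \ {0})`. -/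
theorem IsTestOn.exists_W22 {φ : ℝ → ℝ} (hφ : IsTestOn {0}ᶜ φ) :
    ∃ f : W22, plus f = 0 ∧ minus f = 0 ∧ dplus f = 0 ∧ dminus f = 0 ∧
      (∀ g : L2R, inner ℂ (f : L2R) g = ∫ x, φ x • g x) ∧
      (∀ g : L2R, inner ℂ (D2 f) g = ∫ x, _root_.deriv (_root_.deriv φ) x • g x) := by
  have k1 := hφ.hasWeakDeriv
  have k2 := hφ.deriv.hasWeakDeriv
  have z : ∀ {ψ : ℝ → ℝ}, IsTestOn {0}ᶜ ψ → ((ψ 0 : ℝ) : ℂ) = 0 := fun h => by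
    rw [image_eq_zero_of_notMem_tsupport (fun h' => h.2.2 h' rfl), Complex.ofReal_zero]
  refine ⟨⟨_, k1.mem_W22 k2⟩, ?_, ?_, ?_, ?_, fun g => inner_cut hφ.1.continuous hφ.2.1 g, fun g => ?_⟩
  · exact (valRight_cut .univ (Set.subset_univ _) hφ.1.continuous hφ.2.1).trans (z hφ)
  · exact (valLeft_cut_univ hφ.1.continuous hφ.2.1).trans (z hφ)
  · change valRight (D1 _) = _
    rw [k1.D1_eq]
    exact (valRight_cut _ (Set.subset_univ _) _ _).trans (z hφ.deriv)
  · change valLeft (D1 _) = _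
    rw [k1.D1_eq]
    exact (valLeft_cut_univ _ _).trans (z hφ.deriv)
  · rw [k1.D2_eq _ k2]
    exact inner_cut _ _ _

/-! ### Existence of the first weak derivative -/

/-- The translate `x ↦ f (x + s)`. -/
def translate (s : ℝ) : L2R →ₗ[ℂ] L2R :=
  Lp.compMeasurePreservingₗ ℂ (fun x : ℝ => x + s) (measurePreserving_add_right volume s)

theorem translate_coe (s : ℝ) (f : L2R) : (translate s f : ℝ → ℂ) =ᵐ[volume] fun x => f (x + s) :=
  Lp.coeFn_compMeasurePreserving f (measurePreserving_add_right volume s)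

/-- Strong continuity of translations makes the `L₂`-valued integral in `exists_deriv_Ioi`
meaningful. -/
theorem continuous_translate (f : L2R) : Continuous fun s => translate s f := by
  have hc : Continuous fun s : ℝ => (⟨fun x => x + s, by fun_prop⟩ : C(ℝ, ℝ)) :=
    ContinuousMap.continuous_of_continuous_uncurry _ (by
      change Continuous fun p : ℝ × ℝ => p.2 + p.1
      fun_prop)
  exact (continuous_const (y := f)).compMeasurePreservingLp hc
    (fun s => measurePreserving_add_right volume s) (by norm_num)

theorem integral_smul_translate (u : ℝ → ℝ) (s : ℝ) (f : L2R) :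
    ∫ x, u x • translate s f x = ∫ x, u (x - s) • f x := by
  rw [← integral_add_right_eq_self (fun x => u (x - s) • f x) s]
  refine integral_congr_ae ?_
  filter_upwards [translate_coe s f] with x hx
  rw [hx, add_sub_cancel_right]

/-- The integral is the convolution of `f` with `x ↦ φ (-x)` at `s`, so the derivative falls on the
smooth factor. -/
theorem IsTestOn.hasDerivAt_integral_translate {S : Set ℝ} {φ : ℝ → ℝ} (hφ : IsTestOn S φ)
    (f : L2R) (s : ℝ) :
    HasDerivAt (fun s => ∫ x, φ (x - s) • f x) (-∫ x, _root_.deriv φ (x - s) • f x) s := by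
  have hψ : IsTestOn Set.univ (fun x => φ (-x)) := hφ.comp_neg (by simp)
  have key := hψ.2.1.hasDerivAt_convolution_right ((ContinuousLinearMap.lsmul ℝ ℝ).flip)
    (L2R.locallyIntegrable f) (hψ.1.of_le (by exact_mod_cast le_top)) s
  refine (key.congr_deriv ?_).congr_of_eventuallyEq (Eventually.of_forall fun t => ?_)
  · simp only [convolution_def, ContinuousLinearMap.flip_apply, ContinuousLinearMap.lsmul_apply,
      deriv_comp_neg, neg_sub, neg_smul]
    rw [integral_neg]
  · simp [convolution_def]

theorem IsTestOn.comp_sub {φ : ℝ → ℝ} (hφ : IsTestOn (Set.Ioi 0) φ) {s : ℝ} (hs : 0 ≤ s) :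
    IsTestOn (Set.Ioi 0) (fun x => φ (x - s)) := by
  have e : (fun x => φ (x - s)) = φ ∘ Homeomorph.addRight (-s) := by
    ext x; simp [sub_eq_add_neg]
  refine ⟨hφ.1.comp (contDiff_id.sub contDiff_const), ?_, ?_⟩
  · rw [e]
    exact hφ.2.1.comp_homeomorph _
  · rw [e, tsupport_comp_eq_preimage]
    intro x hx
    have := hφ.2.2 hx
    simp only [Homeomorph.coe_addRight, Set.mem_Ioi] at this ⊢
    linarith

theorem IsTestOn.mono {S T : Set ℝ} (h : S ⊆ T) {φ : ℝ → ℝ} (hφ : IsTestOn S φ) : IsTestOn T φ :=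
  ⟨hφ.1, hφ.2.1, hφ.2.2.trans h⟩

/-- If `g''` lies in `L₂` on `(0, ∞)`, then `g' = g(· + 1) - g - ∫₀¹ (1 - s) g''(· + s) ds` does. -/
theorem exists_deriv_Ioi {g k : L2R}
    (h : ∀ φ, IsTestOn (Set.Ioi 0) φ → ∫ x, deriv (deriv φ) x • g x = ∫ x, φ x • k x) :
    ∃ G : L2R, ∀ φ, IsTestOn (Set.Ioi 0) φ → ∫ x, deriv φ x • g x = -∫ x, φ x • G x := by
  refine ⟨translate 1 g - g - ∫ s in (0 : ℝ)..1, ((1 - s : ℝ) : ℂ) • translate s k, fun φ hφ => ?_⟩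
  -- Pairing with `φ` is a bounded functional on `L₂`, so it passes inside the `L₂`-valued integral.
  obtain ⟨ℓ, hℓ⟩ : ∃ ℓ : L2R →L[ℂ] ℂ, ∀ f : L2R, ℓ f = ∫ x, φ x • f x :=
    ⟨innerSL ℂ (cut MeasurableSet.univ hφ.1.continuous hφ.2.1), inner_cut _ _⟩
  have hcont : Continuous fun s : ℝ => ((1 - s : ℝ) : ℂ) • translate s k :=
    (by fun_prop : Continuous fun s : ℝ => ((1 - s : ℝ) : ℂ)).smul (continuous_translate k)
  have d1 : ∀ s : ℝ, HasDerivAt (fun s => ∫ x, φ (x - s) • g x)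
      (-∫ x, deriv φ (x - s) • g x) s := hφ.hasDerivAt_integral_translate g
  have d2 : ∀ s : ℝ, HasDerivAt (fun s => ∫ x, deriv φ (x - s) • g x)
      (-∫ x, deriv (deriv φ) (x - s) • g x) s := hφ.deriv.hasDerivAt_integral_translate g
  have d3 : Continuous fun s : ℝ => ∫ x, deriv (deriv φ) (x - s) • g x :=
    continuous_iff_continuousAt.2 fun s =>
      (hφ.deriv.deriv.hasDerivAt_integral_translate g s).continuousAt
  -- Since `s ≥ 0`, the shifted test function is still supported in `(0, ∞)` and the hypothesis
  -- applies to it.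
  have e1 : ∀ s ∈ Set.uIcc (0 : ℝ) 1, ℓ (((1 - s : ℝ) : ℂ) • translate s k) =
      ((1 - s : ℝ) : ℂ) * ∫ x, deriv (deriv φ) (x - s) • g x := by
    intro s hs
    rw [Set.uIcc_of_le zero_le_one] at hs
    rw [map_smul, hℓ, integral_smul_translate, ← h _ (hφ.comp_sub hs.1), smul_eq_mul]
    congr 3 with x
    have : deriv (fun x => φ (x - s)) = fun x => deriv φ (x - s) := by
      ext x; exact deriv_comp_sub_const _ _ _
    rw [this, deriv_comp_sub_const]
  -- Taylor's formula with integral remainder, in weak form: an explicit antiderivative in `s` of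
  -- the remainder's integrand.
  have e2 : ∀ s : ℝ, HasDerivAt (fun s : ℝ => (∫ x, φ (x - s) • g x) -
      ((1 - s : ℝ) : ℂ) * ∫ x, deriv φ (x - s) • g x)
      (((1 - s : ℝ) : ℂ) * ∫ x, deriv (deriv φ) (x - s) • g x) s := by
    intro s
    have h0 : HasDerivAt (fun s : ℝ => ((1 - s : ℝ) : ℂ)) (-1 : ℂ) s := by
      have := ((hasDerivAt_id s).const_sub 1).ofReal_comp
      simpa using this
    refine ((d1 s).fun_sub (h0.fun_mul (d2 s))).congr_deriv ?_
    ring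
  have e3 := intervalIntegral.integral_eq_sub_of_hasDerivAt (a := 0) (b := 1) (fun s _ => e2 s)
    (((by fun_prop : Continuous fun s : ℝ => ((1 - s : ℝ) : ℂ)).mul d3).intervalIntegrable _ _)
  rw [← hℓ, map_sub, map_sub, ← ℓ.intervalIntegral_comp_comm (hcont.intervalIntegrable _ _),
    intervalIntegral.integral_congr e1, e3, hℓ, hℓ, integral_smul_translate]
  simp

/-- `φ` vanishes near `0`, so the truncation stays smooth and its support stays away from `0`. -/
theorem IsTestOn.indicator_Ioi {φ : ℝ → ℝ} (hφ : IsTestOn {0}ᶜ φ) :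
    IsTestOn (Set.Ioi 0) ((Set.Ioi 0).indicator φ) := by
  have hsub : tsupport ((Set.Ioi 0).indicator φ) ⊆ tsupport φ :=
    closure_mono (by rw [Set.support_indicator]; exact Set.inter_subset_right)
  refine ⟨?_, hφ.2.1.of_isClosed_subset (isClosed_tsupport _) hsub, ?_⟩
  · rw [contDiff_iff_contDiffAt]
    intro x
    rcases lt_trichotomy x 0 with hx | hx | hx
    · refine (contDiffAt_const (c := (0 : ℝ))).congr_of_eventuallyEq ?_
      filter_upwards [Iio_mem_nhds hx] with y hy
      exact Set.indicator_of_notMem (fun h => lt_asymm h hy) _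
    · refine (contDiffAt_const (c := (0 : ℝ))).congr_of_eventuallyEq ?_
      have : x ∉ tsupport φ := fun h => hφ.2.2 h hx
      filter_upwards [notMem_tsupport_iff_eventuallyEq.1 this] with y hy
      rw [Set.indicator_apply, hy]
      simp
    · refine hφ.1.contDiffAt.congr_of_eventuallyEq ?_
      filter_upwards [Ioi_mem_nhds hx] with y hy
      exact Set.indicator_of_mem hy _
  · intro x hx
    have h0 : x ≠ 0 := hφ.2.2 (hsub hx)
    have h1 : x ∈ Set.Ici (0 : ℝ) := closure_minimal
      (show Function.support ((Set.Ioi 0).indicator φ) ⊆ Set.Ici 0 by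
        rw [Set.support_indicator]
        exact fun y hy => Set.Ioi_subset_Ici_self hy.1) isClosed_Ici hx
    exact lt_of_le_of_ne h1 h0.symm

theorem exists_restrict_Ioi (f : L2R) : ∃ r : L2R, ∀ u : ℝ → ℝ,
    ∫ x, u x • r x = ∫ x, (Set.Ioi 0).indicator u x • f x := by
  have hm := (Lp.memLp f).indicator (measurableSet_Ioi (a := (0 : ℝ)))
  refine ⟨hm.toLp _, fun u => integral_congr_ae ?_⟩
  filter_upwards [hm.coeFn_toLp] with x hx
  rw [hx]
  by_cases h : 0 < x <;> simp [h]

theorem integral_smul_sub {S : Set ℝ} {φ : ℝ → ℝ} (hφ : IsTestOn S φ) (f g : L2R) :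
    ∫ x, φ x • (f - g) x = (∫ x, φ x • f x) - ∫ x, φ x • g x := by
  rw [← integral_sub (L2R.integrable_test hφ f) (L2R.integrable_test hφ g)]
  refine integral_congr_ae ?_
  filter_upwards [Lp.coeFn_sub f g] with x hx
  rw [hx, Pi.sub_apply, smul_sub]

/-- If `g` has a second weak derivative in `L₂(ℝ)`, it also has a first one. -/
theorem exists_hasWeakDeriv_of_second {g k : L2R}
    (h : ∀ φ, IsTestOn {0}ᶜ φ → ∫ x, deriv (deriv φ) x • g x = ∫ x, φ x • k x) :
    ∃ g', HasWeakDeriv g g' ∧ HasWeakDeriv g' k := by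
  have hsub : Set.Ioi (0 : ℝ) ⊆ {0}ᶜ := fun x hx => ne_of_gt hx
  -- Testing a first derivative against `φ'` already makes `k` its weak derivative.
  suffices ∃ g', HasWeakDeriv g g' by
    obtain ⟨g', hg'⟩ := this
    refine ⟨g', hg', fun φ hφ => ?_⟩
    rw [← h φ hφ, hg' _ hφ.deriv, neg_neg]
  obtain ⟨G, hG⟩ := exists_deriv_Ioi fun φ hφ => h φ (hφ.mono hsub)
  -- The left half-line is reflected onto the right one.
  obtain ⟨K, hK⟩ := exists_deriv_Ioi (g := parity g) (k := parity k) (by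
    intro φ hφ
    have e := h _ ((hφ.mono hsub).comp_neg (T := {0}ᶜ) (by simp))
    rw [integral_smul_parity, integral_smul_parity, ← e]
    congr 1 with x
    have : deriv (fun x => φ (-x)) = fun x => -deriv φ (-x) := by
      ext x; exact deriv_comp_neg _ _
    rw [this, deriv.fun_neg, deriv_comp_neg, neg_neg])
  obtain ⟨G', hG'⟩ := exists_restrict_Ioi G
  obtain ⟨K', hK'⟩ := exists_restrict_Ioi K
  -- The two half-line derivatives are glued; the minus sign is the chain rule for the reflection.
  refine ⟨G' - parity K', fun φ hφ => ?_⟩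
  have hψ : IsTestOn {0}ᶜ (fun x => φ (-x)) := hφ.comp_neg (by simp)
  have hp := hφ.indicator_Ioi
  have hm := hψ.indicator_Ioi
  set p := (Set.Ioi 0).indicator φ with hp_def
  set m := (Set.Ioi 0).indicator (fun x => φ (-x)) with hm_def
  have hm' : IsTestOn Set.univ (fun x => m (-x)) := hm.comp_neg (by simp)
  -- At `x = 0` both truncations vanish, and so does `φ`.
  have hsplit : φ = fun x => p x + m (-x) := by
    ext x
    rcases lt_trichotomy x 0 with hx | hx | hx
    · simp [hp_def, hm_def, hx, hx.le]
    · simp [hp_def, hm_def, hx, image_eq_zero_of_notMem_tsupport (fun h' => hφ.2.2 h' rfl)]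
    · simp [hp_def, hm_def, hx, hx.le]
  have hd : ∀ x, deriv φ x = deriv p x + -deriv m (-x) := by
    intro x
    conv_lhs => rw [hsplit]
    rw [deriv_fun_add ((contDiff_infty_iff_deriv.1 hp.1).1 x)
      ((contDiff_infty_iff_deriv.1 hm'.1).1 x), deriv_comp_neg]
  have e1 : ∫ x, deriv φ x • g x = (∫ x, deriv p x • g x) - ∫ x, deriv m (-x) • g x := by
    rw [← integral_sub (L2R.integrable_test hp.deriv g)
      (L2R.integrable_test (hm.deriv.comp_neg (T := Set.univ) (by simp)) g)]
    congr 1 with x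
    rw [hd, add_smul, neg_smul, sub_eq_add_neg]
  rw [integral_smul_sub hφ, integral_smul_parity, hG', hK', e1, hG _ hp,
    ← integral_smul_parity, hK _ hm]
  ring

/-! ### Green's formula and the adjoint of `H_T` -/

/-- Green's formula on `ℝ \ {0}`. -/
theorem inner_D2_sub (f g : W22) :
    inner ℂ (D2 f) (g : L2R) - inner ℂ (f : L2R) (D2 g) =
      conj (dminus f) * minus g - conj (dplus f) * plus g -
        (conj (minus f) * dminus g - conj (plus f) * dplus g) := by
  have h1 := (hasWeakDeriv_D2 f).inner_add_inner (hasWeakDeriv_D1 g)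
  have h2 := (hasWeakDeriv_D1 f).inner_add_inner (hasWeakDeriv_D2 g)
  change _ = conj (dminus f) * minus g - conj (dplus f) * plus g at h1
  change _ = conj (minus f) * dminus g - conj (plus f) * dplus g at h2
  rw [← h1, ← h2]
  ring

theorem meanVal_apply (f : W22) : meanVal f = (plus f + minus f) / 2 := by
  simp only [meanVal, LinearMap.smul_apply, LinearMap.add_apply, smul_eq_mul]; ring

theorem meanDeriv_apply (f : W22) : meanDeriv f = (dplus f + dminus f) / 2 := by
  simp only [meanDeriv, LinearMap.smul_apply, LinearMap.add_apply, smul_eq_mul]; ring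

theorem jumpVal_apply (f : W22) : jumpVal f = plus f - minus f := rfl

theorem jumpDeriv_apply (f : W22) : jumpDeriv f = dplus f - dminus f := rfl

/-- The action of the maximal operator. -/
def maxOp (q₁ q₂ : L2R) (f : W22) : L2R := -D2 f + meanVal f • q₁ - meanDeriv f • q₂

/-- The boundary condition `T Γ₀ f = Γ₁ f`, entry by entry. -/
def Boundary (a b c d : ℂ) (q₁ q₂ : L2R) (f : W22) : Prop :=
  a * meanVal f - b * meanDeriv f = jumpDeriv f - inner ℂ q₁ (f : L2R) ∧
    c * meanVal f - d * meanDeriv f = jumpVal f - inner ℂ q₂ (f : L2R)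

theorem boundaryMap_apply (a b c d : ℂ) (q₁ q₂ : L2R) (f : W22) :
    (!![a, b; c, d].mulVecLin ∘ₗ Gamma0 - Gamma1 q₁ q₂) f =
      ![a * meanVal f - b * meanDeriv f - (jumpDeriv f - inner ℂ q₁ (f : L2R)),
        c * meanVal f - d * meanDeriv f - (jumpVal f - inner ℂ q₂ (f : L2R))] := by
  ext i
  fin_cases i <;>
    simp [Gamma0, Gamma1, dotProduct, Fin.sum_univ_two, sub_eq_add_neg]

theorem mem_ker_boundaryMap {a b c d : ℂ} {q₁ q₂ : L2R} {f : W22} :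
    f ∈ LinearMap.ker (!![a, b; c, d].mulVecLin ∘ₗ Gamma0 - Gamma1 q₁ q₂) ↔
      Boundary a b c d q₁ q₂ f := by
  rw [LinearMap.mem_ker, boundaryMap_apply]
  simp [Boundary, sub_eq_zero]

theorem mem_domain_HT {a b c d : ℂ} {q₁ q₂ x : L2R} :
    x ∈ (HT !![a, b; c, d] q₁ q₂).domain ↔ ∃ hx : x ∈ W22, Boundary a b c d q₁ q₂ ⟨x, hx⟩ := by
  -- `domRestrict` intersects the given subspace with the old domain.
  change x ∈ Submodule.map _ _ ⊓ W22 ↔ _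
  constructor
  · rintro ⟨⟨f, hf, rfl⟩, hx⟩
    exact ⟨hx, mem_ker_boundaryMap.1 hf⟩
  · rintro ⟨hx, h⟩
    exact ⟨⟨⟨x, hx⟩, mem_ker_boundaryMap.2 h, rfl⟩, hx⟩

theorem HT_apply {a b c d : ℂ} {q₁ q₂ : L2R} (x : (HT !![a, b; c, d] q₁ q₂).domain) :
    HT !![a, b; c, d] q₁ q₂ x = maxOp q₁ q₂ ⟨x, (mem_domain_HT.1 x.2).1⟩ := rfl

/-- Formal adjointness of `H_T` and `H_{T†}`, by Green's formula. -/
theorem inner_maxOp {a b c d : ℂ} {q₁ q₂ : L2R} {f g : W22}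
    (hg : Boundary (conj a) (conj c) (conj b) (conj d) q₁ q₂ g)
    (hf : Boundary a b c d q₁ q₂ f) :
    inner ℂ (maxOp q₁ q₂ g) (f : L2R) = inner ℂ (g : L2R) (maxOp q₁ q₂ f) := by
  have e := inner_D2_sub g f
  obtain ⟨f1, f2⟩ := hf
  obtain ⟨g1, g2⟩ := hg
  replace g1 := congrArg conj g1
  replace g2 := congrArg conj g2
  simp only [map_sub, map_mul, Complex.conj_conj, inner_conj_symm] at g1 g2
  simp only [maxOp, inner_add_left, inner_sub_left, inner_neg_left, inner_smul_left,
    inner_add_right, inner_sub_right, inner_neg_right, inner_smul_right]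
  simp only [meanVal_apply, meanDeriv_apply, jumpVal_apply, jumpDeriv_apply, map_div₀, map_add,
    map_sub, map_ofNat] at *
  -- The boundary conditions of `g` are weighted by the entries of `-Γ₀ f`, those of `f` by the
  -- conjugated entries of `Γ₀ g`.
  linear_combination -e - (plus f + minus f) / 2 * g1 + (dplus f + dminus f) / 2 * g2 +
    (conj (plus g) + conj (minus g)) / 2 * f1 - (conj (dplus g) + conj (dminus g)) / 2 * f2

/-- A functional killing the kernel of a linear map factors through that map. This is purely
algebraic: no continuity of `K` is needed. -/
theorem exists_functional_of_ker_le {q₁ q₂ : L2R} {a b c d : ℂ} {K : W22 →ₗ[ℂ] ℂ}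
    (h : ∀ f, Boundary a b c d q₁ q₂ f → K f = 0) : ∃ l m : ℂ, ∀ f : W22,
      K f = l * (a * meanVal f - b * meanDeriv f - (jumpDeriv f - inner ℂ q₁ (f : L2R))) +
        m * (c * meanVal f - d * meanDeriv f - (jumpVal f - inner ℂ q₂ (f : L2R))) := by
  have hK : K ∈ (LinearMap.ker
      (!![a, b; c, d].mulVecLin ∘ₗ Gamma0 - Gamma1 q₁ q₂)).dualAnnihilator := by
    rw [Submodule.mem_dualAnnihilator]
    exact fun f hf => h f (mem_ker_boundaryMap.1 hf)
  rw [← LinearMap.range_dualMap_eq_dualAnnihilator_ker] at hK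
  obtain ⟨ℓ, rfl⟩ := hK
  refine ⟨ℓ (fun j => if 0 = j then 1 else 0), ℓ (fun j => if 1 = j then 1 else 0), fun f => ?_⟩
  rw [LinearMap.dualMap_apply, boundaryMap_apply, LinearMap.pi_apply_eq_sum_univ ℓ]
  simp only [Fin.sum_univ_two, smul_eq_mul, Matrix.cons_val_zero, Matrix.cons_val_one,
    Matrix.cons_val_fin_one]
  ring

/-- The weak form of `h = H_T† g` forces `g` to lie in the domain of `H_{T†}`. -/
theorem boundary_of_weak_adjoint {a b c d : ℂ} {q₁ q₂ g h : L2R}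
    (hgh : ∀ f : W22, Boundary a b c d q₁ q₂ f →
      inner ℂ h (f : L2R) = inner ℂ g (maxOp q₁ q₂ f)) :
    ∃ hg : g ∈ W22, Boundary (conj a) (conj c) (conj b) (conj d) q₁ q₂ ⟨g, hg⟩ ∧
      maxOp q₁ q₂ ⟨g, hg⟩ = h := by
  obtain ⟨l, m, hK⟩ := exists_functional_of_ker_le (q₁ := q₁) (q₂ := q₂) (a := a) (b := b) (c := c)
    (d := d) (K := (innerSL ℂ h).toLinearMap ∘ₗ W22.subtype -
      (innerSL ℂ g).toLinearMap ∘ₗ (-D2 + meanVal.smulRight q₁ - meanDeriv.smulRight q₂))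
    (fun f hf => sub_eq_zero.2 (hgh f hf))
  replace hK : ∀ f : W22, inner ℂ h (f : L2R) - inner ℂ g (maxOp q₁ q₂ f) =
      l * (a * meanVal f - b * meanDeriv f - (jumpDeriv f - inner ℂ q₁ (f : L2R))) +
        m * (c * meanVal f - d * meanDeriv f - (jumpVal f - inner ℂ q₂ (f : L2R))) := hK
  simp only [maxOp, inner_add_right, inner_sub_right, inner_neg_right, inner_smul_right,
    meanVal_apply, meanDeriv_apply, jumpVal_apply, jumpDeriv_apply] at hK
  -- The value that `D2 g` must have if `maxOp` sends `g` to `h`; `conj l` and `conj m` turn out to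
  -- be the entries of `Γ₀ g`.
  set k : L2R := -h + conj l • q₁ + conj m • q₂ with hk
  obtain ⟨g', hg1, hg2⟩ := exists_hasWeakDeriv_of_second (g := g) (k := k) (by
    intro φ hφ
    -- All traces of a test function vanish, so only pairings in `L₂` survive in `hK`.
    obtain ⟨f, f1, f2, f3, f4, f5, f6⟩ := hφ.exists_W22
    rw [← f5, ← f6]
    have e := congrArg conj (hK f)
    rw [f1, f2, f3, f4] at e
    simp only [map_sub, map_add, map_mul, map_neg, inner_conj_symm, map_zero, map_div₀] at e
    simp only [hk, inner_add_right, inner_neg_right, inner_smul_right]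
    linear_combination e)
  have hg : g ∈ W22 := hg1.mem_W22 hg2
  have hD : D2 ⟨g, hg⟩ = k := hg1.D2_eq hg hg2
  set G : W22 := ⟨g, hg⟩ with hG
  -- With `D2 G = k`, Green's formula cancels every pairing that involves `f` itself, leaving a
  -- relation linear in its four traces.
  have key : ∀ f : W22, -(conj (dminus G) * minus f - conj (dplus G) * plus f -
        (conj (minus G) * dminus f - conj (plus G) * dplus f)) -
      (plus f + minus f) / 2 * inner ℂ g q₁ + (dplus f + dminus f) / 2 * inner ℂ g q₂ =
      l * (a * ((plus f + minus f) / 2) - b * ((dplus f + dminus f) / 2) - (dplus f - dminus f)) +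
      m * (c * ((plus f + minus f) / 2) - d * ((dplus f + dminus f) / 2) -
        (plus f - minus f)) := by
    intro f
    have e1 := inner_D2_sub G f
    have e2 := hK f
    rw [hD] at e1
    simp only [hk, inner_add_left, inner_neg_left, inner_smul_left, Complex.conj_conj] at e1
    change _ - inner ℂ g (D2 f) = _ at e1
    linear_combination e2 + e1
  -- `u1` and `u2` have no jumps and give the two boundary conditions; `u3` and `u4` have zero means
  -- and identify `m` and `l`.
  obtain ⟨u1, p1, p2, p3, p4⟩ := exists_traces 1 1 0 0
  obtain ⟨u2, r1, r2, r3, r4⟩ := exists_traces 0 0 1 1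
  obtain ⟨u3, s1, s2, s3, s4⟩ := exists_traces 1 (-1) 0 0
  obtain ⟨u4, t1, t2, t3, t4⟩ := exists_traces 0 0 1 (-1)
  have k1 := congrArg conj (key u1)
  have k2 := congrArg conj (key u2)
  have k3 := congrArg conj (key u3)
  have k4 := congrArg conj (key u4)
  rw [p1, p2, p3, p4] at k1
  rw [r1, r2, r3, r4] at k2
  rw [s1, s2, s3, s4] at k3
  rw [t1, t2, t3, t4] at k4
  simp only [map_sub, map_add, map_mul, map_neg, inner_conj_symm, map_zero, map_div₀, map_one,
    map_ofNat, Complex.conj_conj] at k1 k2 k3 k4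
  have hl : conj l = meanVal G := by
    rw [meanVal_apply]; linear_combination k4 / 2
  have hm : conj m = -meanDeriv G := by
    rw [meanDeriv_apply]; linear_combination k3 / 2
  refine ⟨hg, ⟨?_, ?_⟩, ?_⟩
  · change _ = _ - inner ℂ q₁ g
    rw [hl, hm] at k1
    rw [jumpDeriv_apply]
    linear_combination -k1
  · change _ = _ - inner ℂ q₂ g
    rw [hl, hm] at k2
    rw [jumpVal_apply]
    linear_combination k2
  · rw [maxOp, hD, hk, hl, hm]
    module

/-- A vector `v` orthogonal to the domain satisfies the weak adjoint relation with `g = 0`, hence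
equals `maxOp` of `0`. -/
theorem dense_domain_HT (a b c d : ℂ) (q₁ q₂ : L2R) :
    Dense ((HT !![a, b; c, d] q₁ q₂).domain : Set L2R) := by
  rw [Submodule.dense_iff_topologicalClosure_eq_top, Submodule.topologicalClosure_eq_top_iff,
    Submodule.eq_bot_iff]
  intro v hv
  obtain ⟨h0, -, h⟩ := boundary_of_weak_adjoint (a := a) (b := b) (c := c) (d := d) (q₁ := q₁)
    (q₂ := q₂) (g := 0) (h := v) (fun f hf => by
      rw [inner_zero_left]
      exact Submodule.inner_left_of_mem_orthogonal (mem_domain_HT.2 ⟨f.2, hf⟩) hv)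
  rw [← h]
  have : (⟨0, h0⟩ : W22) = 0 := rfl
  simp [this, maxOp]

theorem mem_adjoint_domain_HT {a b c d : ℂ} {q₁ q₂ y : L2R} :
    y ∈ (HT !![a, b; c, d] q₁ q₂).adjoint.domain ↔
      ∃ hy : y ∈ W22, Boundary (conj a) (conj c) (conj b) (conj d) q₁ q₂ ⟨y, hy⟩ := by
  constructor
  · intro hy
    obtain ⟨hg, h1, -⟩ := boundary_of_weak_adjoint (a := a) (b := b) (c := c) (d := d) (q₁ := q₁)
      (q₂ := q₂) (g := y) (h := (HT !![a, b; c, d] q₁ q₂).adjoint ⟨y, hy⟩) (fun f hf =>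
        LinearPMap.adjoint_isFormalAdjoint (dense_domain_HT a b c d q₁ q₂) ⟨y, hy⟩
          ⟨f, mem_domain_HT.2 ⟨f.2, hf⟩⟩)
    exact ⟨hg, h1⟩
  · rintro ⟨hy, h⟩
    refine LinearPMap.mem_adjoint_domain_of_exists _ ⟨maxOp q₁ q₂ ⟨y, hy⟩, fun x => ?_⟩
    exact inner_maxOp h (mem_domain_HT.1 x.2).2

theorem adjoint_HT_apply {a b c d : ℂ} {q₁ q₂ : L2R}
    (y : (HT !![a, b; c, d] q₁ q₂).adjoint.domain) :
    (HT !![a, b; c, d] q₁ q₂).adjoint y =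
      maxOp q₁ q₂ ⟨y, (mem_adjoint_domain_HT.1 y.2).1⟩ :=
  LinearPMap.adjoint_apply_eq (dense_domain_HT a b c d q₁ q₂) y fun x =>
    inner_maxOp (mem_adjoint_domain_HT.1 y.2).2 (mem_domain_HT.1 x.2).2

/-! ### Parity symmetry of the boundary condition -/

theorem meanVal_parityW (f : W22) : meanVal (parityW f) = meanVal f := by
  rw [meanVal_apply, meanVal_apply, plus_parityW, minus_parityW, add_comm]

theorem meanDeriv_parityW (f : W22) : meanDeriv (parityW f) = -meanDeriv f := by
  rw [meanDeriv_apply, meanDeriv_apply, dplus_parityW, dminus_parityW]; ring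

theorem jumpVal_parityW (f : W22) : jumpVal (parityW f) = -jumpVal f := by
  rw [jumpVal_apply, jumpVal_apply, plus_parityW, minus_parityW]; ring

theorem jumpDeriv_parityW (f : W22) : jumpDeriv (parityW f) = jumpDeriv f := by
  rw [jumpDeriv_apply, jumpDeriv_apply, dplus_parityW, dminus_parityW]; ring

/-- The even `q₁` multiplies the parity-invariant mean value, and the odd `q₂` the mean derivative,
which changes sign. -/
theorem maxOp_parityW {q₁ q₂ : L2R} (hq₁ : parity q₁ = q₁) (hq₂ : parity q₂ = -q₂) (f : W22) :
    maxOp q₁ q₂ (parityW f) = parity (maxOp q₁ q₂ f) := by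
  simp only [maxOp, map_add, map_sub, map_neg, map_smul, hq₁, hq₂, D2_parityW, meanVal_parityW,
    meanDeriv_parityW]
  module

/-- Parity fixes the mean value, the derivative jump and the pairing with `q₁`, and negates the mean
derivative, the value jump and the pairing with `q₂`. Hence only `b` and `c` change sign, once the
second equation is multiplied by `-1`. -/
theorem Boundary.parityW {a b c d : ℂ} {q₁ q₂ : L2R} (hq₁ : parity q₁ = q₁)
    (hq₂ : parity q₂ = -q₂) {f : W22} (h : Boundary a b c d q₁ q₂ f) :
    Boundary a (-b) (-c) d q₁ q₂ (parityW f) := by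
  obtain ⟨h1, h2⟩ := h
  rw [Boundary, meanVal_parityW, meanDeriv_parityW, jumpVal_parityW, jumpDeriv_parityW,
    parityW_coe, ← inner_parity, ← inner_parity, hq₁, hq₂, inner_neg_left]
  exact ⟨by linear_combination h1, by linear_combination -h2⟩

end NonlocalPoint

end

theorem lemma3p3 (a b c d : ℂ) (q₁ q₂ : NonlocalPoint.L2R)
    (ha : a.im = 0) (hd : d.im = 0) (hbc : b = -(starRingEnd ℂ) c)
    (hq₁ : NonlocalPoint.parity q₁ = q₁) (hq₂ : NonlocalPoint.parity q₂ = -q₂) :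
    NonlocalPoint.IsParitySelfAdjoint (NonlocalPoint.HT !![a, b; c, d] q₁ q₂) := by
  open NonlocalPoint in
  have ca : (starRingEnd ℂ) a = a := Complex.conj_eq_iff_im.2 ha
  have cd : (starRingEnd ℂ) d = d := Complex.conj_eq_iff_im.2 hd
  have cc : (starRingEnd ℂ) c = -b := by rw [hbc, neg_neg]
  have cb : (starRingEnd ℂ) b = -c := by rw [hbc, map_neg, Complex.conj_conj]
  have hdom : ∀ x : L2R, x ∈ (HT !![a, b; c, d] q₁ q₂).domain ↔
      parity x ∈ (HT !![a, b; c, d] q₁ q₂).adjoint.domain := by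
    intro x
    -- Here the hypotheses on the matrix enter: `T†` becomes `T` with `b` and `c` negated.
    rw [mem_domain_HT, mem_adjoint_domain_HT, ca, cb, cc, cd]
    constructor
    · rintro ⟨hx, h⟩
      exact ⟨(parityW ⟨x, hx⟩).2, h.parityW hq₁ hq₂⟩
    · rintro ⟨hx, h⟩
      -- Parity is an involution: reflecting `parity x` recovers `x` and the signs of `b` and `c`.
      have hp : (parityW ⟨parity x, hx⟩ : L2R) = x := parity_parity x
      have h2 := h.parityW hq₁ hq₂
      rw [neg_neg, neg_neg] at h2
      refine ⟨hp ▸ (parityW ⟨parity x, hx⟩).2, ?_⟩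
      convert h2
      exact hp.symm
  refine ⟨dense_domain_HT a b c d q₁ q₂, LinearPMap.ext (Submodule.ext hdom) ?_⟩
  intro x hx hx'
  change parity (HT !![a, b; c, d] q₁ q₂ ⟨x, hx⟩) =
    (HT !![a, b; c, d] q₁ q₂).adjoint ⟨parity x, hx'⟩
  rw [HT_apply, adjoint_HT_apply, ← maxOp_parityW hq₁ hq₂]
  rfl
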